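/- **Setting and conventions.** Let $(M,g)$ be a smooth four-dimensional spacetime of signature $(-,+,+,+)$, with $\nabla_\mu\nabla_\nu V^\sigma-\nabla_\nu\nabla_\mu V^\sigma=R^\sigma{}_{\rho\mu\nu}V^\rho$, $R_{\mu\nu}=R^\sigma{}_{\mu\sigma\nu}$, and Weyl tensor $C_{\mu\nu\rho\sigma}$. Square brackets denote antisymmetrisation without a factor $\tfrac12$: $W_{[MN]}=W_{MN}-W_{NM}$. Let $\Phi:\mathbb R\times\mathbb S^2\to M$ be a smooth embedding whose image $\mathcal H$ is a null hypersurface, with coordinates $\xi^1$ on $\mathbb R$ and local coordinates $\xi^M=(\xi^2,\xi^3)$ on $\mathbb S^2$, such that $n=e_1=d\Phi(\partial_{\xi^1})$ is normal to $\mathcal H$. Put $e_M=d\Phi(\partial_{\xi^M})$ and let the rigging $\ell$ be the vector field along $\mathcal H$ with $g(\ell,\ell)=0$, $g(\ell,n)=1$, $g(\ell,e_M)=0$. Set $$q_{MN}=g(e_M,e_N),\quad \Theta_{MN}=g(\nabla_{e_M}n,e_N),\quad \Omega_M=g(\nabla_{e_M}n,\ell),\quad \Xi_{MN}=\tfrac12\big(g(\nabla_{e_M}\ell,e_N)+g(\nabla_{e_N}\ell,e_M)\big).$$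 Let $D_M$, $\mathcal R$ and $\epsilon_{MN}$ be the Levi-Civita connection, the scalar curvature and the volume form (with $\epsilon_{23}>0$) of $q_{MN}$. Assume that $\mathcal H$ is a non-expanding horizon, $\theta=q^{MN}\Theta_{MN}=0$ everywhere, and that it is embedded in vacuum, $R_{\mu\nu}=0$ at the points of $\mathcal H$. Define the scalar $\mathcal J$ by $D_{[M}\Omega_{N]}=\epsilon_{MN}\,\mathcal J$. At a point $\xi_0$ at which the coordinates $\xi^M$ are such that $q_{MN}(\xi_0)=\delta_{MN}$, let $m=\frac1{\sqrt2}(e_2+\mathrm i e_3)$, $\overline m=\frac1{\sqrt2}(e_2-\mathrm i e_3)$, and define the Weyl scalars $$\Psi_0=C(n,m,n,m),\quad \Psi_1=C(n,m,\ell,n),\quad \Psi_2=C(n,m,\ell,\overline m),\quad \Psi_3=C(n,\ell,\overline m,\ell).$$ **Lemma.** At $\xi_0$, $$\Psi_0=\Psi_1=0,\qquad \Psi_2=-\tfrac14\mathcal R+\tfrac{\mathrm i}{2}\mathcal J,$$ $$\operatorname{Re}\Psi_3=\tfrac1{\sqrt2}\big(D_{[M}\Xi_{2]N}+\Omega_{[M}\Xi_{2]N}\big)q^{MN},\qquad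 \operatorname{Im}\Psi_3=-\tfrac1{\sqrt2}\big(D_{[M}\Xi_{3]N}+\Omega_{[M}\Xi_{3]N}\big)q^{MN}.$$ -/

import Mathlib

open scoped Manifold ContDiff

noncomputable section

/-! ## Tensor calculus in local coordinates

`G : EuclideanSpace ℝ ι → Matrix ι ι ℝ` is the component matrix of a (pseudo-)Riemannian metric in
a coordinate system with coordinates indexed by `ι`. -/

namespace CoordGeom

variable {ι : Type*} [Fintype ι] [DecidableEq ι]

/-- The partial derivative `∂_k f`. -/
def pderiv (k : ι) (f : EuclideanSpace ℝ ι → ℝ) (x : EuclideanSpace ℝ ι) : ℝ :=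
  fderiv ℝ f x (EuclideanSpace.single k 1)

/-- The Christoffel symbol `Γ^k_{ij}` of the Levi-Civita connection of `G`. -/
def christoffel (G : EuclideanSpace ℝ ι → Matrix ι ι ℝ) (x : EuclideanSpace ℝ ι)
    (k i j : ι) : ℝ :=
  (1 / 2) * ∑ l, (G x)⁻¹ k l *
    (pderiv i (fun y => G y l j) x + pderiv j (fun y => G y l i) x - pderiv l (fun y => G y i j) x)

/-- The Riemann tensor `R^s_{r m n}`, with `∇_m ∇_n V^s - ∇_n ∇_m V^s = R^s_{r m n} V^r`. -/
def riemannUp (G : EuclideanSpace ℝ ι → Matrix ι ι ℝ) (x : EuclideanSpace ℝ ι)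
    (s r m n : ι) : ℝ :=
  pderiv m (fun y => christoffel G y s n r) x - pderiv n (fun y => christoffel G y s m r) x
    + ∑ l, (christoffel G x s m l * christoffel G x l n r
          - christoffel G x s n l * christoffel G x l m r)

/-- The Riemann tensor with all indices lowered, `R_{s r m n} = G_{s l} R^l_{r m n}`. -/
def riemann (G : EuclideanSpace ℝ ι → Matrix ι ι ℝ) (x : EuclideanSpace ℝ ι)
    (s r m n : ι) : ℝ :=
  ∑ l, G x s l * riemannUp G x l r m n

/-- The Ricci tensor `R_{m n} = R^s_{m s n}`. -/
def ricci (G : EuclideanSpace ℝ ι → Matrix ι ι ℝ) (x : EuclideanSpace ℝ ι) (m n : ι) : ℝ :=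
  ∑ s, riemannUp G x s m s n

/-- The scalar curvature `G^{m n} R_{m n}`. -/
def scalarCurvature (G : EuclideanSpace ℝ ι → Matrix ι ι ℝ) (x : EuclideanSpace ℝ ι) : ℝ :=
  ∑ m, ∑ n, (G x)⁻¹ m n * ricci G x m n

/-- The covariant derivative `D_a w_b` of a one-form `w`. -/
def covDerivOneForm (G : EuclideanSpace ℝ ι → Matrix ι ι ℝ) (w : EuclideanSpace ℝ ι → ι → ℝ)
    (x : EuclideanSpace ℝ ι) (a b : ι) : ℝ :=
  pderiv a (fun y => w y b) x - ∑ l, christoffel G x l a b * w x l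

/-- The covariant derivative `D_a T_{b c}` of a covariant two-tensor `T`. -/
def covDerivTwoTensor (G : EuclideanSpace ℝ ι → Matrix ι ι ℝ)
    (T : EuclideanSpace ℝ ι → ι → ι → ℝ) (x : EuclideanSpace ℝ ι) (a b c : ι) : ℝ :=
  pderiv a (fun y => T y b c) x
    - ∑ l, christoffel G x l a b * T x l c - ∑ l, christoffel G x l a c * T x b l

/-- In dimension four, the Schouten tensor in the normalisation `S_{m n} = R_{m n} - R G_{m n} / 6`.
-/
def schouten (G : EuclideanSpace ℝ (Fin 4) → Matrix (Fin 4) (Fin 4) ℝ)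
    (x : EuclideanSpace ℝ (Fin 4)) (m n : Fin 4) : ℝ :=
  ricci G x m n - (1 / 6) * scalarCurvature G x * G x m n

/-- The Weyl tensor `C_{s r m n}` in dimension four:
`R_{srmn} = C_{srmn} + (1/2) (G_{sm} S_{nr} - G_{sn} S_{mr} - G_{rm} S_{ns} + G_{rn} S_{ms})`. -/
def weyl (G : EuclideanSpace ℝ (Fin 4) → Matrix (Fin 4) (Fin 4) ℝ)
    (x : EuclideanSpace ℝ (Fin 4)) (s r m n : Fin 4) : ℝ :=
  riemann G x s r m n - (1 / 2) *
    ((G x s m * schouten G x n r - G x s n * schouten G x m r)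
      - (G x r m * schouten G x n s - G x r n * schouten G x m s))

/-- The contraction `C_{s r m n} A^s B^r C^m D^n` of the Weyl tensor with complex vectors. -/
def weylContract (G : EuclideanSpace ℝ (Fin 4) → Matrix (Fin 4) (Fin 4) ℝ)
    (x : EuclideanSpace ℝ (Fin 4)) (A B C D : Fin 4 → ℂ) : ℂ :=
  ∑ s, ∑ r, ∑ m, ∑ n, (weyl G x s r m n : ℂ) * A s * B r * C m * D n

end CoordGeom

/-! ## Lorentzian four-manifolds -/

/-- A smooth metric of signature `(-,+,+,+)` on a four-manifold. -/
structure LorentzMetric (M : Type*) [TopologicalSpace M]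
    [ChartedSpace (EuclideanSpace ℝ (Fin 4)) M] [IsManifold (𝓡 4) ∞ M] where
  /-- The scalar product on the tangent spaces. -/
  inner (p : M) : TangentSpace (𝓡 4) p →L[ℝ] TangentSpace (𝓡 4) p →L[ℝ] ℝ
  symm (p : M) (v w : TangentSpace (𝓡 4) p) : inner p v w = inner p w v
  signature (p : M) : ∃ b : Module.Basis (Fin 4) ℝ (TangentSpace (𝓡 4) p),
    ∀ i j, inner p (b i) (b j) = Matrix.diagonal ![(-1 : ℝ), 1, 1, 1] i j
  contMDiff : ContMDiff (𝓡 4)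
    ((𝓡 4).prod 𝓘(ℝ, EuclideanSpace ℝ (Fin 4) →L[ℝ] EuclideanSpace ℝ (Fin 4) →L[ℝ] ℝ)) ∞
    (fun p ↦ Bundle.TotalSpace.mk'
      (EuclideanSpace ℝ (Fin 4) →L[ℝ] EuclideanSpace ℝ (Fin 4) →L[ℝ] ℝ) p (inner p))

/-- The two-sphere. -/
abbrev TwoSphere : Type := Metric.sphere (0 : EuclideanSpace ℝ (Fin 3)) 1

section Spacetime

variable {M : Type*} [TopologicalSpace M] [ChartedSpace (EuclideanSpace ℝ (Fin 4)) M]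
  [IsManifold (𝓡 4) ∞ M]

/-- The components `g_{μν}` of the metric in the coordinate system `φ`, as functions of the
coordinates. -/
def LorentzMetric.coord (g : LorentzMetric M)
    (φ : OpenPartialHomeomorph M (EuclideanSpace ℝ (Fin 4))) (x : EuclideanSpace ℝ (Fin 4)) :
    Matrix (Fin 4) (Fin 4) ℝ :=
  Matrix.of fun μ ν => g.inner (φ.symm x)
    (mfderiv (𝓡 4) (𝓡 4) φ.symm x (EuclideanSpace.single μ (1 : ℝ)))
    (mfderiv (𝓡 4) (𝓡 4) φ.symm x (EuclideanSpace.single ν (1 : ℝ)))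

/-- The vacuum Einstein equations `R_{μν} = 0` hold at all points of `S`
(for the components in every coordinate system of the smooth structure). -/
def LorentzMetric.IsVacuumOn (g : LorentzMetric M) (S : Set M) : Prop :=
  ∀ φ ∈ IsManifold.maximalAtlas (𝓡 4) ∞ M, ∀ p ∈ φ.source, p ∈ S →
    ∀ μ ν, CoordGeom.ricci (g.coord φ) (φ p) μ ν = 0

/-- A null hypersurface `Φ : ℝ × S² → M` with its adapted rigging. The first coordinate `ξ¹` of
`ℝ × S²` is such that `n = dΦ(∂/∂ξ¹)` is normal to the hypersurface; the rigging `ℓ` is the null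
vector field along the hypersurface with `g(ℓ, n) = 1` that is orthogonal to the sections of
constant `ξ¹`. -/
structure NullHypersurface (g : LorentzMetric M) where
  /-- The embedding. -/
  Φ : ℝ × TwoSphere → M
  isSmoothEmbedding : Manifold.IsSmoothEmbedding (𝓘(ℝ, ℝ).prod (𝓡 2)) (𝓡 4) ∞ Φ
  normal_orthogonal (p : ℝ × TwoSphere) (X : TangentSpace (𝓘(ℝ, ℝ).prod (𝓡 2)) p) :
    g.inner (Φ p)
      (mfderiv (𝓘(ℝ, ℝ).prod (𝓡 2)) (𝓡 4) Φ p ((1 : ℝ), (0 : EuclideanSpace ℝ (Fin 2))))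
      (mfderiv (𝓘(ℝ, ℝ).prod (𝓡 2)) (𝓡 4) Φ p X) = 0
  /-- The rigging. -/
  ell (p : ℝ × TwoSphere) : TangentSpace (𝓡 4) (Φ p)
  ell_smooth : ContMDiff (𝓘(ℝ, ℝ).prod (𝓡 2)) (𝓡 4).tangent ∞
    (fun p => (⟨Φ p, ell p⟩ : TangentBundle (𝓡 4) M))
  ell_null (p : ℝ × TwoSphere) : g.inner (Φ p) (ell p) (ell p) = 0
  ell_tangent (p : ℝ × TwoSphere) (t : ℝ) (v : EuclideanSpace ℝ (Fin 2)) :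
    g.inner (Φ p) (ell p) (mfderiv (𝓘(ℝ, ℝ).prod (𝓡 2)) (𝓡 4) Φ p (t, v)) = t

namespace NullHypersurface

variable {g : LorentzMetric M} (H : NullHypersurface g)
  (φ : OpenPartialHomeomorph M (EuclideanSpace ℝ (Fin 4)))
  (ψ : OpenPartialHomeomorph TwoSphere (EuclideanSpace ℝ (Fin 2)))

/-! In what follows `φ` is a coordinate system `x^μ` of the spacetime and `ψ` is a coordinate system
`(ξ², ξ³)` of the sphere, so that `ξ = (ξ¹, (ξ², ξ³)) : ℝ × ℝ²` are coordinates of the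
hypersurface. Upper case indices `A B : Fin 2` stand for the coordinates `ξ², ξ³` (that is, `0` and
`1` stand for `2` and `3`). Vectors along the hypersurface are represented by their components in
the coordinate basis of `φ`. -/

/-- The point of the hypersurface with coordinates `ξ`. -/
def point (ξ : ℝ × EuclideanSpace ℝ (Fin 2)) : M := H.Φ (ξ.1, ψ.symm ξ.2)

/-- The coordinate expression `x^μ(ξ)` of the embedding. -/
def embed (ξ : ℝ × EuclideanSpace ℝ (Fin 2)) : EuclideanSpace ℝ (Fin 4) := φ (H.point ψ ξ)

/-- The null normal `n = e₁ = ∂x/∂ξ¹`. -/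
def normal (ξ : ℝ × EuclideanSpace ℝ (Fin 2)) : EuclideanSpace ℝ (Fin 4) :=
  fderiv ℝ (H.embed φ ψ) ξ (1, 0)

/-- The tangent vectors `e_A = ∂x/∂ξ^A`. -/
def frame (A : Fin 2) (ξ : ℝ × EuclideanSpace ℝ (Fin 2)) : EuclideanSpace ℝ (Fin 4) :=
  fderiv ℝ (H.embed φ ψ) ξ (0, EuclideanSpace.single A 1)

/-- The components of the rigging `ℓ`. -/
def rigging (ξ : ℝ × EuclideanSpace ℝ (Fin 2)) : EuclideanSpace ℝ (Fin 4) :=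
  mfderiv (𝓡 4) (𝓡 4) φ (H.point ψ ξ) (H.ell (ξ.1, ψ.symm ξ.2))

/-- The scalar product `g_{μν} v^μ w^ν` at the point with coordinates `ξ`. -/
def dot (ξ : ℝ × EuclideanSpace ℝ (Fin 2)) (v w : EuclideanSpace ℝ (Fin 4)) : ℝ :=
  ∑ μ, ∑ ν, g.coord φ (H.embed φ ψ ξ) μ ν * v μ * w ν

/-- The spacetime Levi-Civita derivative of a vector field `V` along the hypersurface, in the
direction of the tangent vector with components `w` in the coordinates `ξ`. -/
def nabla (w : ℝ × EuclideanSpace ℝ (Fin 2))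
    (V : ℝ × EuclideanSpace ℝ (Fin 2) → EuclideanSpace ℝ (Fin 4))
    (ξ : ℝ × EuclideanSpace ℝ (Fin 2)) : EuclideanSpace ℝ (Fin 4) :=
  WithLp.toLp 2 fun μ => fderiv ℝ V ξ w μ + ∑ ν, ∑ ρ,
    CoordGeom.christoffel (g.coord φ) (H.embed φ ψ ξ) μ ν ρ *
      fderiv ℝ (H.embed φ ψ) ξ w ν * V ξ ρ

/-- `∇_A V`, the derivative along `e_A`. -/
def nablaFrame (A : Fin 2) (V : ℝ × EuclideanSpace ℝ (Fin 2) → EuclideanSpace ℝ (Fin 4))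
    (ξ : ℝ × EuclideanSpace ℝ (Fin 2)) : EuclideanSpace ℝ (Fin 4) :=
  H.nabla φ ψ (0, EuclideanSpace.single A 1) V ξ

/-- The induced metric `q_{AB} = g(e_A, e_B)` of the sections of constant `ξ¹`. -/
def q (ξ : ℝ × EuclideanSpace ℝ (Fin 2)) : Matrix (Fin 2) (Fin 2) ℝ :=
  Matrix.of fun A B => H.dot φ ψ ξ (H.frame φ ψ A ξ) (H.frame φ ψ B ξ)

/-- The induced metric on the section through `ξ`, as a function of `(ξ², ξ³)`. -/
def sectionMetric (ξ : ℝ × EuclideanSpace ℝ (Fin 2)) (y : EuclideanSpace ℝ (Fin 2)) :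
    Matrix (Fin 2) (Fin 2) ℝ :=
  H.q φ ψ (ξ.1, y)

/-- The second fundamental form `Θ_{AB} = g(∇_A n, e_B)`. -/
def secondFundamentalForm (ξ : ℝ × EuclideanSpace ℝ (Fin 2)) (A B : Fin 2) : ℝ :=
  H.dot φ ψ ξ (H.nablaFrame φ ψ A (H.normal φ ψ) ξ) (H.frame φ ψ B ξ)

/-- The expansion `θ = q^{AB} Θ_{AB}`. -/
def expansion (ξ : ℝ × EuclideanSpace ℝ (Fin 2)) : ℝ :=
  ∑ A, ∑ B, (H.q φ ψ ξ)⁻¹ A B * H.secondFundamentalForm φ ψ ξ A B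

/-- The Hajicek one-form `Ω_A = g(∇_A n, ℓ)`. -/
def hajicek (ξ : ℝ × EuclideanSpace ℝ (Fin 2)) (A : Fin 2) : ℝ :=
  H.dot φ ψ ξ (H.nablaFrame φ ψ A (H.normal φ ψ) ξ) (H.rigging φ ψ ξ)

/-- The transverse connection `Ξ_{AB} = (1/2) (g(∇_A ℓ, e_B) + g(∇_B ℓ, e_A))`. -/
def transverse (ξ : ℝ × EuclideanSpace ℝ (Fin 2)) (A B : Fin 2) : ℝ :=
  (1 / 2) * (H.dot φ ψ ξ (H.nablaFrame φ ψ A (H.rigging φ ψ) ξ) (H.frame φ ψ B ξ)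
    + H.dot φ ψ ξ (H.nablaFrame φ ψ B (H.rigging φ ψ) ξ) (H.frame φ ψ A ξ))

/-- The scalar curvature `𝓡` of `q_{AB}`. -/
def sectionCurvature (ξ : ℝ × EuclideanSpace ℝ (Fin 2)) : ℝ :=
  CoordGeom.scalarCurvature (H.sectionMetric φ ψ ξ) ξ.2

/-- `D_A Ω_B`, with `D` the Levi-Civita connection of `q_{AB}`. -/
def dHajicek (ξ : ℝ × EuclideanSpace ℝ (Fin 2)) (A B : Fin 2) : ℝ :=
  CoordGeom.covDerivOneForm (H.sectionMetric φ ψ ξ) (fun y => H.hajicek φ ψ (ξ.1, y)) ξ.2 A B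

/-- `D_A Ξ_{BC}`. -/
def dTransverse (ξ : ℝ × EuclideanSpace ℝ (Fin 2)) (A B C : Fin 2) : ℝ :=
  CoordGeom.covDerivTwoTensor (H.sectionMetric φ ψ ξ) (fun y => H.transverse φ ψ (ξ.1, y)) ξ.2 A B C

/-- The volume form `ε_{AB}` of `q_{AB}`, oriented by the coordinates `(ξ², ξ³)`. -/
def volumeForm (ξ : ℝ × EuclideanSpace ℝ (Fin 2)) (A B : Fin 2) : ℝ :=
  Real.sqrt (H.q φ ψ ξ).det * !![0, 1; -1, 0] A B

/-- The scalar
`(D_A Ξ_{BC} - D_B Ξ_{AC} + Ω_A Ξ_{BC} - Ω_B Ξ_{AC}) q^{AC}`. -/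
def transverseCurl (ξ : ℝ × EuclideanSpace ℝ (Fin 2)) (B : Fin 2) : ℝ :=
  ∑ A, ∑ C, ((H.dTransverse φ ψ ξ A B C - H.dTransverse φ ψ ξ B A C)
    + (H.hajicek φ ψ ξ A * H.transverse φ ψ ξ B C - H.hajicek φ ψ ξ B * H.transverse φ ψ ξ A C))
      * (H.q φ ψ ξ)⁻¹ A C

/-- A non-expanding horizon: a null hypersurface whose expansion vanishes everywhere. -/
def IsNonExpanding : Prop :=
  ∀ φ ∈ IsManifold.maximalAtlas (𝓡 4) ∞ M, ∀ ψ ∈ IsManifold.maximalAtlas (𝓡 2) ∞ TwoSphere,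
    ∀ ξ : ℝ × EuclideanSpace ℝ (Fin 2), ξ.2 ∈ ψ.target → H.point ψ ξ ∈ φ.source →
      H.expansion φ ψ ξ = 0

/-! The Newman-Penrose tetrad `n, ℓ, m, m̄` at a point where `q_{AB} = δ_{AB}`, and the Weyl
scalars. -/

/-- `n` as a complex vector. -/
def npN (ξ : ℝ × EuclideanSpace ℝ (Fin 2)) (μ : Fin 4) : ℂ := (H.normal φ ψ ξ μ : ℂ)

/-- `ℓ` as a complex vector. -/
def npL (ξ : ℝ × EuclideanSpace ℝ (Fin 2)) (μ : Fin 4) : ℂ := (H.rigging φ ψ ξ μ : ℂ)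

/-- `m = (e₂ + i e₃) / √2`. -/
def npM (ξ : ℝ × EuclideanSpace ℝ (Fin 2)) (μ : Fin 4) : ℂ :=
  ((H.frame φ ψ 0 ξ μ : ℂ) + Complex.I * (H.frame φ ψ 1 ξ μ : ℂ)) / (Real.sqrt 2 : ℂ)

/-- `m̄ = (e₂ - i e₃) / √2`. -/
def npMbar (ξ : ℝ × EuclideanSpace ℝ (Fin 2)) (μ : Fin 4) : ℂ :=
  ((H.frame φ ψ 0 ξ μ : ℂ) - Complex.I * (H.frame φ ψ 1 ξ μ : ℂ)) / (Real.sqrt 2 : ℂ)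

/-- `Ψ₀ = C(n, m, n, m)`. -/
def Psi0 (ξ : ℝ × EuclideanSpace ℝ (Fin 2)) : ℂ :=
  CoordGeom.weylContract (g.coord φ) (H.embed φ ψ ξ)
    (H.npN φ ψ ξ) (H.npM φ ψ ξ) (H.npN φ ψ ξ) (H.npM φ ψ ξ)

/-- `Ψ₁ = C(n, m, ℓ, n)`. -/
def Psi1 (ξ : ℝ × EuclideanSpace ℝ (Fin 2)) : ℂ :=
  CoordGeom.weylContract (g.coord φ) (H.embed φ ψ ξ)
    (H.npN φ ψ ξ) (H.npM φ ψ ξ) (H.npL φ ψ ξ) (H.npN φ ψ ξ)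

/-- `Ψ₂ = C(n, m, ℓ, m̄)`. -/
def Psi2 (ξ : ℝ × EuclideanSpace ℝ (Fin 2)) : ℂ :=
  CoordGeom.weylContract (g.coord φ) (H.embed φ ψ ξ)
    (H.npN φ ψ ξ) (H.npM φ ψ ξ) (H.npL φ ψ ξ) (H.npMbar φ ψ ξ)

/-- `Ψ₃ = C(n, ℓ, m̄, ℓ)`. -/
def Psi3 (ξ : ℝ × EuclideanSpace ℝ (Fin 2)) : ℂ :=
  CoordGeom.weylContract (g.coord φ) (H.embed φ ψ ξ)
    (H.npN φ ψ ξ) (H.npL φ ψ ξ) (H.npMbar φ ψ ξ) (H.npL φ ψ ξ)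

end NullHypersurface

end Spacetime

end

open scoped Manifold ContDiff

set_option linter.unusedSectionVars false

/-! ### Coordinate calculus: Christoffel symbols of the first kind and the symmetries of the Riemann
tensor. -/

namespace CoordGeom

variable {ι : Type*} [Fintype ι] [DecidableEq ι]

/-! In vacuum the Weyl and Riemann tensors agree at the points of the horizon, so each Weyl scalar
is a combination of components of Riemann in the real frame `n`, `ℓ`, `e_A`. When the last two slots
are tangent to the horizon, such a component consists of derivatives of scalar products g(W, ∇V) and
of products g(∇W, ∇V) (`RegularAt.riemannContract_eq`), hence of connection coefficients of the
frame.

The decisive step is Raychaudhuri's equation: since θ = 0 near the point and Ric(n,n) = 0, the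
trace-free symmetric form Θ has determinant zero, and positivity of q forces Θ = 0
(`secondForm_eq_zero`). Therefore ∇_A n = Ω_A n (`UnitHorizonAt.dot_nabla_one`), and the rest
follows: - R(e_B, n, e_A, n) = 0, which is Ψ₀ = 0. Also R(e_B, n, e_A, e_C) = 0, and then Ric(n,
e_A) = 0 leaves R(ℓ, n, n, e_A) = 0, which is Ψ₁ = 0. - R(ℓ, n, e_A, e_B) is the curl of Ω. Gauss'
equation has no extrinsic term, because that term would pair Θ with Ξ; so R(e_2, e_3, e_2, e_3) is
half the scalar curvature of q. The equations Ric(e_A, e_A) = 0 then give Re Ψ₂, and the first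
Bianchi identity gives Im Ψ₂. - The Codazzi equation for ℓ gives R(e_C, ℓ, e_A, e_B) in terms of DΞ
and ΩΞ. Its trace is turned into R(n, ℓ, e_B, ℓ) by Ric(ℓ, e_B) = 0, which is Ψ₃.

The computation takes place in one chart, with `X` the coordinate form of the embedding, n = ∂₁X and
e_A = ∂_A X. The condition q = δ holds only at the given point, so whatever is to be differentiated
is first proved nearby for a general positive definite q: this is the role of `HorizonAt`, as
opposed to `UnitHorizonAt`. -/

lemma contDiffAt_pderiv {f : EuclideanSpace ℝ ι → ℝ} {x : EuclideanSpace ℝ ι}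
    (hf : ContDiffAt ℝ ∞ f x) (k : ι) : ContDiffAt ℝ ∞ (pderiv k f) x :=
  (hf.fderiv_right (m := ∞) (by simp)).clm_apply contDiffAt_const

lemma pderiv_comm {f : EuclideanSpace ℝ ι → ℝ} {x : EuclideanSpace ℝ ι}
    (hf : ContDiffAt ℝ ∞ f x) (k l : ι) :
    pderiv k (pderiv l f) x = pderiv l (pderiv k f) x := by
  have hd : DifferentiableAt ℝ (fderiv ℝ f) x :=
    (hf.fderiv_right (m := ∞) (by simp)).differentiableAt (by simp)
  have h : ∀ v w, fderiv ℝ (fun y => fderiv ℝ f y v) x w = fderiv ℝ (fderiv ℝ f) x w v := by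
    intro v w
    rw [fderiv_clm_apply hd (differentiableAt_const v)]
    simp
  have hs := hf.isSymmSndFDerivAt (by simpa using ENat.LEInfty.out)
  change fderiv ℝ (fun y => fderiv ℝ f y _) x _ = fderiv ℝ (fun y => fderiv ℝ f y _) x _
  rw [h, h]
  exact hs _ _

/-- The entries of the inverse are cofactors divided by the determinant, hence rational in the
entries. -/
lemma contDiffAt_inv_apply {F : Type*} [NormedAddCommGroup F] [NormedSpace ℝ F]
    {A : F → Matrix ι ι ℝ} {x : F} (hA : ∀ i j, ContDiffAt ℝ ∞ (fun y => A y i j) x)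
    (hdet : (A x).det ≠ 0) (i j : ι) : ContDiffAt ℝ ∞ (fun y => (A y)⁻¹ i j) x := by
  have hd : ∀ B : F → Matrix ι ι ℝ, (∀ i j, ContDiffAt ℝ ∞ (fun y => B y i j) x) →
      ContDiffAt ℝ ∞ (fun y => (B y).det) x := by
    intro B hB
    simp only [Matrix.det_apply']
    exact ContDiffAt.sum fun σ _ => contDiffAt_const.mul (contDiffAt_prod fun i _ => hB _ _)
  simp only [Matrix.inv_def, Matrix.smul_apply, Ring.inverse_eq_inv', smul_eq_mul,
    Matrix.adjugate_apply]
  refine ((hd A hA).inv hdet).mul (hd _ fun k l => ?_)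
  by_cases hk : k = j
  · subst hk; simp only [Matrix.updateRow_self]; exact contDiffAt_const
  · simp only [Matrix.updateRow_ne hk]; exact hA k l

/-- The Christoffel symbol of the first kind `Γ_{l,ij}`. -/
noncomputable def christoffelLower (G : EuclideanSpace ℝ ι → Matrix ι ι ℝ) (x : EuclideanSpace ℝ ι)
    (l i j : ι) : ℝ :=
  (1 / 2) * (pderiv i (fun y => G y l j) x + pderiv j (fun y => G y l i) x
    - pderiv l (fun y => G y i j) x)

variable {G : EuclideanSpace ℝ ι → Matrix ι ι ℝ} {x : EuclideanSpace ℝ ι}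

lemma christoffel_eq_sum (k i j : ι) :
    christoffel G x k i j = ∑ l, (G x)⁻¹ k l * christoffelLower G x l i j := by
  simp only [christoffel, christoffelLower, Finset.mul_sum]
  exact Finset.sum_congr rfl fun l _ => by ring

lemma sum_mul_christoffel (hdet : (G x).det ≠ 0) (l i j : ι) :
    ∑ k, G x l k * christoffel G x k i j = christoffelLower G x l i j := by
  have h : G x * (G x)⁻¹ = 1 := Matrix.mul_nonsing_inv _ (isUnit_iff_ne_zero.mpr hdet)
  have h2 : (G x).mulVec ((G x)⁻¹.mulVec fun l => christoffelLower G x l i j)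
      = fun l => christoffelLower G x l i j := by rw [Matrix.mulVec_mulVec, h, Matrix.one_mulVec]
  rw [← congrFun h2 l]
  simp only [Matrix.mulVec, dotProduct, christoffel_eq_sum]

lemma metric_symm (hG : ∀ y, (G y).IsSymm) (i j : ι) : (fun y => G y i j) = fun y => G y j i :=
  funext fun y => (hG y).apply j i

lemma christoffelLower_symm (hG : ∀ y, (G y).IsSymm) (l i j : ι) :
    christoffelLower G x l i j = christoffelLower G x l j i := by
  simp only [christoffelLower]; rw [metric_symm hG i j]; ring

lemma christoffel_symm (hG : ∀ y, (G y).IsSymm) (l i j : ι) :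
    christoffel G x l i j = christoffel G x l j i := by
  simp only [christoffel_eq_sum]
  exact Finset.sum_congr rfl fun k _ => by rw [christoffelLower_symm hG]

/-- Metric compatibility in coordinates: it trades every first derivative of the metric for
Christoffel symbols. -/
lemma pderiv_metric (hG : ∀ y, (G y).IsSymm) (i j k : ι) :
    pderiv i (fun y => G y j k) x = christoffelLower G x j i k + christoffelLower G x k i j := by
  simp only [christoffelLower]; rw [metric_symm hG k j, metric_symm hG i j, metric_symm hG i k]; ring

lemma contDiffAt_christoffelLower (hs : ∀ i j, ContDiffAt ℝ ∞ (fun y => G y i j) x) (l i j : ι) :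
    ContDiffAt ℝ ∞ (fun y => christoffelLower G y l i j) x :=
  contDiffAt_const.mul (((contDiffAt_pderiv (hs l j) i).add (contDiffAt_pderiv (hs l i) j)).sub
    (contDiffAt_pderiv (hs i j) l))

lemma contDiffAt_christoffel (hs : ∀ i j, ContDiffAt ℝ ∞ (fun y => G y i j) x)
    (hdet : (G x).det ≠ 0) (l i j : ι) :
    ContDiffAt ℝ ∞ (fun y => christoffel G y l i j) x := by
  simp only [christoffel_eq_sum]
  exact ContDiffAt.sum fun k _ =>
    (contDiffAt_inv_apply hs hdet l k).mul (contDiffAt_christoffelLower hs k i j)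

lemma eventually_det_ne_zero {F : Type*} [TopologicalSpace F] {A : F → Matrix ι ι ℝ} {x : F}
    (hs : ∀ i j, ContinuousAt (fun y => A y i j) x) (hdet : (A x).det ≠ 0) :
    ∀ᶠ y in nhds x, (A y).det ≠ 0 := by
  have h : ContinuousAt A x := continuousAt_pi.mpr fun i => continuousAt_pi.mpr fun j => hs i j
  exact (Continuous.matrix_det continuous_id).continuousAt.comp h |>.eventually_ne hdet

/-- The product rule for directional derivatives of finite sums of products. -/
lemma fderiv_sum_mul_apply {F κ : Type*} [NormedAddCommGroup F] [NormedSpace ℝ F] [Fintype κ]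
    {f h : κ → F → ℝ} {x : F} (hf : ∀ k, DifferentiableAt ℝ (f k) x)
    (hh : ∀ k, DifferentiableAt ℝ (h k) x) (v : F) :
    fderiv ℝ (fun y => ∑ k, f k y * h k y) x v
      = ∑ k, (fderiv ℝ (f k) x v * h k x + f k x * fderiv ℝ (h k) x v) := by
  rw [fderiv_fun_sum fun k _ => (hf k).fun_mul (hh k)]
  simp only [sum_apply]
  refine Finset.sum_congr rfl fun k _ => ?_
  rw [fderiv_fun_mul (hf k) (hh k)]
  simp only [add_apply, smul_apply, smul_eq_mul]
  ring

/-- The contraction `G^{lk} Γ_{l,ab} Γ_{k,cd}`. -/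
lemma sum_christoffelLower_mul_christoffel_comm (hG : ∀ y, (G y).IsSymm) (a b c d : ι) :
    ∑ l, christoffelLower G x l a b * christoffel G x l c d
      = ∑ l, christoffelLower G x l c d * christoffel G x l a b := by
  have hinv : (G x)⁻¹.IsSymm := by
    rw [Matrix.IsSymm, Matrix.transpose_nonsing_inv, (hG x).eq]
  simp only [christoffel_eq_sum, Finset.mul_sum]
  rw [Finset.sum_comm]
  refine Finset.sum_congr rfl fun l _ => Finset.sum_congr rfl fun k _ => ?_
  rw [hinv.apply]; ring

/-- The product rule applied to G Γ = Γ with lowered index, so that the inverse metric never has to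
be differentiated. -/
lemma sum_mul_pderiv_christoffel (hG : ∀ y, (G y).IsSymm)
    (hs : ∀ i j, ContDiffAt ℝ ∞ (fun y => G y i j) x) (hdet : (G x).det ≠ 0) (s m n r : ι) :
    ∑ l, G x s l * pderiv m (fun y => christoffel G y l n r) x
      = pderiv m (fun y => christoffelLower G y s n r) x
        - ∑ l, (christoffelLower G x s m l + christoffelLower G x l m s) * christoffel G x l n r := by
  have hd {f : EuclideanSpace ℝ ι → ℝ} (h : ContDiffAt ℝ ∞ f x) : DifferentiableAt ℝ f x :=
    h.differentiableAt (by simp)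
  have h1 : (fun y => christoffelLower G y s n r)
      =ᶠ[nhds x] fun y => ∑ l, G y s l * christoffel G y l n r :=
    (eventually_det_ne_zero (fun i j => (hs i j).continuousAt) hdet).mono
      fun y hy => (sum_mul_christoffel hy s n r).symm
  rw [pderiv, h1.fderiv_eq, fderiv_sum_mul_apply (fun l => hd (hs s l))
    fun l => hd (contDiffAt_christoffel hs hdet l n r), ← Finset.sum_sub_distrib]
  refine Finset.sum_congr rfl fun l _ => ?_
  rw [← pderiv_metric hG]; simp only [pderiv]; ring

/-- The Riemann tensor in terms of the Christoffel symbols of the first kind. -/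
lemma riemann_eq (hG : ∀ y, (G y).IsSymm)
    (hs : ∀ i j, ContDiffAt ℝ ∞ (fun y => G y i j) x) (hdet : (G x).det ≠ 0) (s r m n : ι) :
    riemann G x s r m n = pderiv m (fun y => christoffelLower G y s n r) x
      - pderiv n (fun y => christoffelLower G y s m r) x
      - ∑ l, christoffelLower G x l m s * christoffel G x l n r
      + ∑ l, christoffelLower G x l n s * christoffel G x l m r := by
  have h : ∀ m n, ∑ l, G x s l * ∑ k, christoffel G x l m k * christoffel G x k n r
      = ∑ k, christoffelLower G x s m k * christoffel G x k n r := by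
    intro m n
    simp only [Finset.mul_sum]
    rw [Finset.sum_comm]
    refine Finset.sum_congr rfl fun k _ => ?_
    rw [← sum_mul_christoffel hdet, Finset.sum_mul]
    exact Finset.sum_congr rfl fun l _ => by ring
  simp only [riemann, riemannUp, mul_add, mul_sub, Finset.sum_add_distrib, Finset.sum_sub_distrib]
  rw [h, h, sum_mul_pderiv_christoffel hG hs hdet, sum_mul_pderiv_christoffel hG hs hdet]
  simp only [add_mul, Finset.sum_add_distrib]
  ring

lemma pderiv_christoffelLower (hs : ∀ i j, ContDiffAt ℝ ∞ (fun y => G y i j) x) (m s n r : ι) :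
    pderiv m (fun y => christoffelLower G y s n r) x
      = (1 / 2) * (pderiv m (pderiv n fun y => G y s r) x + pderiv m (pderiv r fun y => G y s n) x
        - pderiv m (pderiv s fun y => G y n r) x) := by
  have hd (i j k : ι) : DifferentiableAt ℝ (pderiv i fun y => G y j k) x :=
    (contDiffAt_pderiv (hs j k) i).differentiableAt (by simp)
  simp only [christoffelLower]
  conv_lhs => rw [pderiv]
  rw [fderiv_const_mul (((hd _ _ _).fun_add (hd _ _ _)).fun_sub (hd _ _ _)),
    fderiv_fun_sub ((hd _ _ _).fun_add (hd _ _ _)) (hd _ _ _), fderiv_fun_add (hd _ _ _) (hd _ _ _)]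
  rfl

/-- `R_{srmn} = ½ (∂_m ∂_r G_{sn} - ∂_m ∂_s G_{nr} - ∂_n ∂_r G_{sm} + ∂_n ∂_s G_{mr}) + Γ Γ`. -/
lemma riemann_eq_second_derivatives (hG : ∀ y, (G y).IsSymm)
    (hs : ∀ i j, ContDiffAt ℝ ∞ (fun y => G y i j) x) (hdet : (G x).det ≠ 0) (s r m n : ι) :
    riemann G x s r m n = (1 / 2) * (pderiv m (pderiv r fun y => G y s n) x
        - pderiv m (pderiv s fun y => G y n r) x - pderiv n (pderiv r fun y => G y s m) x
        + pderiv n (pderiv s fun y => G y m r) x)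
      - ∑ l, christoffelLower G x l m s * christoffel G x l n r
      + ∑ l, christoffelLower G x l n s * christoffel G x l m r := by
  rw [riemann_eq hG hs hdet, pderiv_christoffelLower hs, pderiv_christoffelLower hs,
    pderiv_comm (hs s r) m n]
  ring

lemma riemann_antisymm_right (s r m n : ι) : riemann G x s r m n = -riemann G x s r n m := by
  simp only [riemann, riemannUp, ← Finset.sum_neg_distrib, ← mul_neg]
  refine Finset.sum_congr rfl fun l _ => ?_
  congr 1
  rw [neg_add, ← Finset.sum_neg_distrib]
  congr 1
  · ring
  · exact Finset.sum_congr rfl fun k _ => by ring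

/-- The second-derivative terms are exchanged because partial derivatives commute; the quadratic
terms are exchanged because the inverse metric is symmetric. -/
lemma riemann_pair_symm (hG : ∀ y, (G y).IsSymm)
    (hs : ∀ i j, ContDiffAt ℝ ∞ (fun y => G y i j) x) (hdet : (G x).det ≠ 0) (s r m n : ι) :
    riemann G x s r m n = riemann G x m n s r := by
  rw [riemann_eq_second_derivatives hG hs hdet, riemann_eq_second_derivatives hG hs hdet,
    pderiv_comm (hs s n) m r, metric_symm hG s n, pderiv_comm (hs n r) m s, metric_symm hG n r,
    pderiv_comm (hs s m) n r, metric_symm hG s m, pderiv_comm (hs m r) n s,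
    sum_christoffelLower_mul_christoffel_comm hG n s m r]
  simp only [christoffelLower_symm hG _ m s, christoffelLower_symm hG _ m r,
    christoffel_symm hG _ n r, christoffel_symm hG _ n s]
  ring

lemma riemann_antisymm_left (hG : ∀ y, (G y).IsSymm)
    (hs : ∀ i j, ContDiffAt ℝ ∞ (fun y => G y i j) x) (hdet : (G x).det ≠ 0) (s r m n : ι) :
    riemann G x s r m n = -riemann G x r s m n := by
  rw [riemann_pair_symm hG hs hdet, riemann_antisymm_right, riemann_pair_symm hG hs hdet]

/-- The first Bianchi identity. -/
lemma riemann_bianchi (hG : ∀ y, (G y).IsSymm) (s r m n : ι) :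
    riemann G x s r m n + riemann G x s m n r + riemann G x s n r m = 0 := by
  simp only [riemann, ← Finset.sum_add_distrib, ← mul_add]
  refine Finset.sum_eq_zero fun l _ => ?_
  simp only [riemannUp, Finset.sum_sub_distrib]
  have h (a b : ι) : (fun y => christoffel G y l a b) = fun y => christoffel G y l b a :=
    funext fun y => christoffel_symm hG _ _ _
  rw [h r n, h m n, h m r]
  simp only [christoffel_symm hG _ r n, christoffel_symm hG _ m n, christoffel_symm hG _ m r]
  ring

end CoordGeom

/-! ### Contractions of the curvature with vectors, and traces in an arbitrary frame. -/

namespace CoordGeom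

variable {ι : Type*} [Fintype ι] [DecidableEq ι]

/-- The scalar product `A_{μν} v^μ w^ν`. -/
def dot (A : Matrix ι ι ℝ) (v w : EuclideanSpace ℝ ι) : ℝ :=
  ∑ μ, ∑ ν, A μ ν * v μ * w ν

lemma dot_comm {A : Matrix ι ι ℝ} (hA : A.IsSymm) (v w : EuclideanSpace ℝ ι) :
    dot A v w = dot A w v := by
  simp only [dot]
  rw [Finset.sum_comm]
  exact Finset.sum_congr rfl fun i _ => Finset.sum_congr rfl fun j _ => by rw [hA.apply]; ring

lemma dot_add_left (A : Matrix ι ι ℝ) (u v w : EuclideanSpace ℝ ι) :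
    dot A (u + v) w = dot A u w + dot A v w := by
  simp only [dot, ← Finset.sum_add_distrib, PiLp.add_apply]
  exact Finset.sum_congr rfl fun i _ => Finset.sum_congr rfl fun j _ => by ring

/-- The contraction `R_{srmn} A^s B^r C^m D^n` of the Riemann tensor. -/
noncomputable def riemannContract (G : EuclideanSpace ℝ ι → Matrix ι ι ℝ) (x : EuclideanSpace ℝ ι)
    (A B C D : EuclideanSpace ℝ ι) : ℝ :=
  ∑ s, ∑ r, ∑ m, ∑ n, riemann G x s r m n * A s * B r * C m * D n

/-- The contraction `R_{mn} A^m B^n` of the Ricci tensor. -/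
noncomputable def ricciContract (G : EuclideanSpace ℝ ι → Matrix ι ι ℝ) (x : EuclideanSpace ℝ ι)
    (A B : EuclideanSpace ℝ ι) : ℝ :=
  ∑ m, ∑ n, ricci G x m n * A m * B n

section Symmetries

variable {G : EuclideanSpace ℝ ι → Matrix ι ι ℝ} {x : EuclideanSpace ℝ ι}

lemma riemannContract_antisymm_right (A B C D : EuclideanSpace ℝ ι) :
    riemannContract G x A B C D = -riemannContract G x A B D C := by
  simp only [riemannContract, ← Finset.sum_neg_distrib]
  refine Finset.sum_congr rfl fun s _ => Finset.sum_congr rfl fun r _ => ?_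
  rw [Finset.sum_comm]
  refine Finset.sum_congr rfl fun m _ => Finset.sum_congr rfl fun n _ => ?_
  rw [riemann_antisymm_right]; ring

lemma riemannContract_antisymm_left (hG : ∀ y, (G y).IsSymm)
    (hs : ∀ i j, ContDiffAt ℝ ∞ (fun y => G y i j) x) (hdet : (G x).det ≠ 0)
    (A B C D : EuclideanSpace ℝ ι) :
    riemannContract G x A B C D = -riemannContract G x B A C D := by
  simp only [riemannContract, ← Finset.sum_neg_distrib]
  rw [Finset.sum_comm]
  refine Finset.sum_congr rfl fun s _ => Finset.sum_congr rfl fun r _ =>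
    Finset.sum_congr rfl fun m _ => Finset.sum_congr rfl fun n _ => ?_
  rw [riemann_antisymm_left hG hs hdet]; ring

lemma riemannContract_pair_symm (hG : ∀ y, (G y).IsSymm)
    (hs : ∀ i j, ContDiffAt ℝ ∞ (fun y => G y i j) x) (hdet : (G x).det ≠ 0)
    (A B C D : EuclideanSpace ℝ ι) :
    riemannContract G x A B C D = riemannContract G x C D A B := by
  simp only [riemannContract]
  have h : ∀ s, ∑ r, ∑ m, ∑ n, riemann G x s r m n * A s * B r * C m * D n
      = ∑ m, ∑ n, ∑ r, riemann G x s r m n * A s * B r * C m * D n := fun s => by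
    rw [Finset.sum_comm]; exact Finset.sum_congr rfl fun m _ => Finset.sum_comm
  simp only [h]
  rw [Finset.sum_comm]
  refine Finset.sum_congr rfl fun s _ => ?_
  rw [Finset.sum_comm]
  refine Finset.sum_congr rfl fun r _ =>
    Finset.sum_congr rfl fun m _ => Finset.sum_congr rfl fun n _ => ?_
  rw [riemann_pair_symm hG hs hdet]; ring

lemma riemannContract_bianchi (hG : ∀ y, (G y).IsSymm) (A B C D : EuclideanSpace ℝ ι) :
    riemannContract G x A B C D + riemannContract G x A C D B + riemannContract G x A D B C
      = 0 := by
  simp only [riemannContract, ← Finset.sum_add_distrib]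
  refine Finset.sum_eq_zero fun s _ => ?_
  have h1 : ∑ r, ∑ m, ∑ n, riemann G x s r m n * A s * C r * D m * B n
      = ∑ r, ∑ m, ∑ n, riemann G x s m n r * A s * B r * C m * D n := by
    rw [Finset.sum_comm_cycle]
    refine Finset.sum_congr rfl fun r _ => Finset.sum_congr rfl fun m _ =>
      Finset.sum_congr rfl fun n _ => by ring
  have h2 : ∑ r, ∑ m, ∑ n, riemann G x s r m n * A s * D r * B m * C n
      = ∑ r, ∑ m, ∑ n, riemann G x s n r m * A s * B r * C m * D n := by
    rw [← Finset.sum_comm_cycle]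
    refine Finset.sum_congr rfl fun r _ => Finset.sum_congr rfl fun m _ =>
      Finset.sum_congr rfl fun n _ => by ring
  simp only [Finset.sum_add_distrib]
  rw [h1, h2]
  simp only [← Finset.sum_add_distrib]
  refine Finset.sum_eq_zero fun r _ => Finset.sum_eq_zero fun m _ => Finset.sum_eq_zero fun n _ => ?_
  linear_combination (A s * B r * C m * D n) * riemann_bianchi (x := x) hG s r m n

end Symmetries

section Frame

variable {G : EuclideanSpace ℝ ι → Matrix ι ι ℝ} {x : EuclideanSpace ℝ ι}
  {P : ι → EuclideanSpace ℝ ι} {Δ : Matrix ι ι ℝ}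

/-- If the Gram matrix of `P` with respect to `A` is invertible with inverse `Δ`, then
`A⁻¹ = Δ^{IJ} P_I ⊗ P_J`. -/
lemma mul_frame_eq_one {A : Matrix ι ι ℝ}
    (h : Matrix.of (fun I J => dot A (P I) (P J)) * Δ = 1) :
    A * Matrix.of (fun s t => ∑ I, ∑ J, Δ I J * P I s * P J t) = 1 := by
  set B : Matrix ι ι ℝ := Matrix.of fun s I => P I s
  have h1 : Matrix.of (fun I J => dot A (P I) (P J)) = B.transpose * (A * B) := by
    ext I J
    simp only [dot, Matrix.mul_apply, Matrix.of_apply, B, Matrix.transpose_apply, Finset.mul_sum]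
    exact Finset.sum_congr rfl fun i _ => Finset.sum_congr rfl fun j _ => by ring
  have h2 : Matrix.of (fun s t => ∑ I, ∑ J, Δ I J * P I s * P J t) = B * Δ * B.transpose := by
    ext s t
    simp only [Matrix.mul_apply, Matrix.of_apply, B, Matrix.transpose_apply, Finset.sum_mul]
    rw [Finset.sum_comm]
    exact Finset.sum_congr rfl fun i _ => Finset.sum_congr rfl fun j _ => by ring
  -- The Gram matrix is BᵀAB. One-sided inverses of square matrices are two-sided, so BᵀABΔ = 1
  -- rotates to ABΔBᵀ = 1.
  rw [h1, Matrix.mul_assoc] at h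
  rw [h2, ← mul_eq_one_comm.mp h]
  simp only [Matrix.mul_assoc]

/-- This is how nondegeneracy of the coordinate metric along the horizon is obtained: from the frame
`n`, `ℓ`, `e_A`. -/
lemma det_ne_zero_of_frame {A : Matrix ι ι ℝ}
    (h : Matrix.of (fun I J => dot A (P I) (P J)) * Δ = 1) : A.det ≠ 0 := by
  have := congrArg Matrix.det (mul_frame_eq_one h)
  rw [Matrix.det_mul, Matrix.det_one] at this
  exact left_ne_zero_of_mul_eq_one this

lemma sum_frame_mul (f : ι → ι → ℝ) :
    ∑ s, ∑ t, (∑ I, ∑ J, Δ I J * P I s * P J t) * f s t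
      = ∑ I, ∑ J, Δ I J * ∑ s, ∑ t, P I s * P J t * f s t := by
  simp only [Finset.sum_mul, Finset.mul_sum]
  rw [Finset.sum_comm_cycle]
  refine Finset.sum_congr rfl fun I _ => ?_
  rw [Finset.sum_comm_cycle]
  exact Finset.sum_congr rfl fun J _ => Finset.sum_congr rfl fun s _ =>
    Finset.sum_congr rfl fun t _ => by ring

/-- Completeness relation: A = A A⁻¹ A, with A⁻¹ expanded in the frame. -/
lemma dot_eq_sum_frame {A : Matrix ι ι ℝ} (hA : A.IsSymm)
    (h : Matrix.of (fun I J => dot A (P I) (P J)) * Δ = 1) (u v : EuclideanSpace ℝ ι) :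
    dot A u v = ∑ I, ∑ J, Δ I J * dot A u (P I) * dot A v (P J) := by
  have h1 := mul_frame_eq_one h
  have h2 (a b : EuclideanSpace ℝ ι) : dot A a b = a.ofLp ⬝ᵥ A.mulVec b.ofLp := by
    simp only [dot, dotProduct, Matrix.mulVec, Finset.mul_sum]
    exact Finset.sum_congr rfl fun i _ => Finset.sum_congr rfl fun j _ => by ring
  have h3 : dot A u v = (A.mulVec u.ofLp) ⬝ᵥ
      (Matrix.of (fun s t => ∑ I, ∑ J, Δ I J * P I s * P J t)).mulVec (A.mulVec v.ofLp) := by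
    rw [h2, Matrix.mulVec_mulVec, mul_eq_one_comm.mp h1, Matrix.one_mulVec,
      Matrix.dotProduct_mulVec, ← Matrix.mulVec_transpose, hA.eq]
  have h4 (I : ι) (a : EuclideanSpace ℝ ι) : dot A a (P I) = ∑ s, P I s * A.mulVec a.ofLp s := by
    rw [dot_comm hA, h2]; rfl
  rw [h3]
  simp only [h4]
  generalize A.mulVec u.ofLp = a
  generalize A.mulVec v.ofLp = b
  calc _ = ∑ s, ∑ t, (∑ I, ∑ J, Δ I J * P I s * P J t) * (a s * b t) := by
        simp only [dotProduct, Matrix.mulVec, Matrix.of_apply]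
        refine Finset.sum_congr rfl fun s _ => ?_
        rw [Finset.mul_sum]
        exact Finset.sum_congr rfl fun t _ => by ring
    _ = _ := by
        rw [sum_frame_mul]
        refine Finset.sum_congr rfl fun I _ => Finset.sum_congr rfl fun J _ => ?_
        rw [mul_assoc, Finset.sum_mul_sum]
        congr 1
        exact Finset.sum_congr rfl fun s _ => Finset.sum_congr rfl fun t _ => by ring

/-- Lets the vacuum equations be read as linear relations between frame components of Riemann. -/
lemma ricciContract_eq_sum_frame
    (h : Matrix.of (fun I J => dot (G x) (P I) (P J)) * Δ = 1) (Y Z : EuclideanSpace ℝ ι) :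
    ricciContract G x Y Z = ∑ I, ∑ J, Δ I J * riemannContract G x (P J) Y (P I) Z := by
  have h1 := mul_frame_eq_one h
  set K : ι → ι → ℝ := fun s t => ∑ I, ∑ J, Δ I J * P I s * P J t with hK
  have h2 (s r m n : ι) : riemannUp G x s r m n
      = ∑ t, K s t * riemann G x t r m n := by
    have := congrFun (congrArg (fun B : Matrix ι ι ℝ => B.mulVec fun l => riemannUp G x l r m n)
      (mul_eq_one_comm.mp h1)) s
    simp only [← Matrix.mulVec_mulVec, Matrix.one_mulVec] at this
    rw [← this]
    rfl
  calc ricciContract G x Y Z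
      = ∑ s, ∑ t, K s t * ∑ m, ∑ n, riemann G x t m s n * Y m * Z n := by
        simp only [ricciContract, ricci, h2]
        simp only [Finset.sum_mul, Finset.mul_sum]
        rw [Finset.sum_comm_cycle]
        refine Finset.sum_congr rfl fun s _ => ?_
        rw [Finset.sum_comm_cycle]
        exact Finset.sum_congr rfl fun t _ => Finset.sum_congr rfl fun m _ =>
          Finset.sum_congr rfl fun n _ => by ring
    _ = _ := by
        rw [hK, sum_frame_mul]
        refine Finset.sum_congr rfl fun I _ => Finset.sum_congr rfl fun J _ => ?_
        congr 1
        rw [Finset.sum_comm]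
        simp only [riemannContract, Finset.mul_sum]
        refine Finset.sum_congr rfl fun s _ => ?_
        rw [Finset.sum_comm]
        refine Finset.sum_congr rfl fun m _ => Finset.sum_congr rfl fun t _ =>
          Finset.sum_congr rfl fun n _ => by ring

end Frame

end CoordGeom

/-! ### The Levi-Civita derivative along a map: compatibility, torsion, curvature. -/

namespace CoordGeom

variable {ι : Type*} [Fintype ι] [DecidableEq ι]

section Along

variable {F : Type*} [NormedAddCommGroup F] [NormedSpace ℝ F]
  {G : EuclideanSpace ℝ ι → Matrix ι ι ℝ} {X V W : F → EuclideanSpace ℝ ι} {ξ : F}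

/-- The Levi-Civita derivative of the vector field `V` along the map `X` in the direction `w`. -/
noncomputable def nablaAlong (G : EuclideanSpace ℝ ι → Matrix ι ι ℝ) (X : F → EuclideanSpace ℝ ι)
    (w : F) (V : F → EuclideanSpace ℝ ι) (ξ : F) : EuclideanSpace ℝ ι :=
  WithLp.toLp 2 fun μ => fderiv ℝ V ξ w μ + ∑ ν, ∑ ρ,
    christoffel G (X ξ) μ ν ρ * fderiv ℝ X ξ w ν * V ξ ρ

lemma nablaAlong_apply (w : F) (μ : ι) : nablaAlong G X w V ξ μ = fderiv ℝ V ξ w μ + ∑ ν, ∑ ρ,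
    christoffel G (X ξ) μ ν ρ * fderiv ℝ X ξ w ν * V ξ ρ := rfl

lemma contDiffAt_fderiv_apply {E : Type*} [NormedAddCommGroup E] [NormedSpace ℝ E] {f : F → E}
    (hf : ContDiffAt ℝ ∞ f ξ) (w : F) : ContDiffAt ℝ ∞ (fun ζ => fderiv ℝ f ζ w) ξ :=
  (hf.fderiv_right (m := ∞) (by simp)).clm_apply contDiffAt_const

lemma fderiv_fderiv_comm {E : Type*} [NormedAddCommGroup E] [NormedSpace ℝ E] {f : F → E}
    (hf : ContDiffAt ℝ ∞ f ξ) (v w : F) :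
    fderiv ℝ (fun ζ => fderiv ℝ f ζ v) ξ w = fderiv ℝ (fun ζ => fderiv ℝ f ζ w) ξ v := by
  have hd : DifferentiableAt ℝ (fderiv ℝ f) ξ :=
    (hf.fderiv_right (m := ∞) (by simp)).differentiableAt (by simp)
  rw [fderiv_clm_apply hd (differentiableAt_const v), fderiv_clm_apply hd (differentiableAt_const w)]
  simpa using hf.isSymmSndFDerivAt (by simpa using ENat.LEInfty.out) w v

lemma contDiffAt_component (hV : ContDiffAt ℝ ∞ V ξ) (μ : ι) :
    ContDiffAt ℝ ∞ (fun ζ => V ζ μ) ξ := (contDiffAt_euclidean.mp hV) μ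

lemma fderiv_component (hV : DifferentiableAt ℝ V ξ) (w : F) (μ : ι) :
    fderiv ℝ (fun ζ => V ζ μ) ξ w = fderiv ℝ V ξ w μ := by
  have := ((EuclideanSpace.proj (𝕜 := ℝ) μ).hasFDerivAt.comp ξ hV.hasFDerivAt).fderiv
  exact congrArg (fun T : F →L[ℝ] ℝ => T w) this

lemma fderiv_comp_eq_sum {f : EuclideanSpace ℝ ι → ℝ} (hf : DifferentiableAt ℝ f (X ξ))
    (hX : DifferentiableAt ℝ X ξ) (w : F) :
    fderiv ℝ (fun ζ => f (X ζ)) ξ w = ∑ μ, pderiv μ f (X ξ) * fderiv ℝ X ξ w μ := by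
  have h1 : fderiv ℝ (fun ζ => f (X ζ)) ξ w = fderiv ℝ f (X ξ) (fderiv ℝ X ξ w) := by
    rw [← Function.comp_def, fderiv_comp ξ hf hX]; rfl
  have h2 (u : EuclideanSpace ℝ ι) : u = ∑ μ, u μ • EuclideanSpace.single μ (1 : ℝ) := by
    ext i; simp [Finset.sum_apply, Pi.single_apply]
  rw [h1]
  conv_lhs => rw [h2 (fderiv ℝ X ξ w)]
  simp only [map_sum, map_smul, smul_eq_mul, pderiv]
  exact Finset.sum_congr rfl fun _ _ => mul_comm _ _

lemma contDiffAt_dot {A : F → Matrix ι ι ℝ} (hA : ∀ i j, ContDiffAt ℝ ∞ (fun ζ => A ζ i j) ξ)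
    (hV : ContDiffAt ℝ ∞ V ξ) (hW : ContDiffAt ℝ ∞ W ξ) :
    ContDiffAt ℝ ∞ (fun ζ => dot (A ζ) (V ζ) (W ζ)) ξ :=
  ContDiffAt.sum fun i _ => ContDiffAt.sum fun j _ =>
    ((hA i j).mul (contDiffAt_component hV i)).mul (contDiffAt_component hW j)

/-- The hypotheses under which the Levi-Civita derivative along `X` is well behaved at `ξ`. -/
structure RegularAt (G : EuclideanSpace ℝ ι → Matrix ι ι ℝ) (X : F → EuclideanSpace ℝ ι)
    (ξ : F) : Prop where
  symm : ∀ y, (G y).IsSymm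
  smooth_metric : ∀ i j, ContDiffAt ℝ ∞ (fun y => G y i j) (X ξ)
  det_ne_zero : (G (X ξ)).det ≠ 0
  smooth : ContDiffAt ℝ ∞ X ξ

namespace RegularAt

lemma contDiffAt_christoffel (h : RegularAt G X ξ) (μ ν ρ : ι) :
    ContDiffAt ℝ ∞ (fun ζ => christoffel G (X ζ) μ ν ρ) ξ :=
  (CoordGeom.contDiffAt_christoffel h.smooth_metric h.det_ne_zero μ ν ρ).comp ξ h.smooth

lemma contDiffAt_nablaAlong (h : RegularAt G X ξ) (hV : ContDiffAt ℝ ∞ V ξ) (w : F) :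
    ContDiffAt ℝ ∞ (nablaAlong G X w V) ξ :=
  contDiffAt_euclidean.mpr fun μ =>
    (contDiffAt_component (contDiffAt_fderiv_apply hV w) μ).add <|
      ContDiffAt.sum fun ν _ => ContDiffAt.sum fun ρ _ =>
        ((h.contDiffAt_christoffel μ ν ρ).mul
          (contDiffAt_component (contDiffAt_fderiv_apply h.smooth w) ν)).mul
          (contDiffAt_component hV ρ)

lemma contDiffAt_dot (h : RegularAt G X ξ) (hV : ContDiffAt ℝ ∞ V ξ) (hW : ContDiffAt ℝ ∞ W ξ) :
    ContDiffAt ℝ ∞ (fun ζ => dot (G (X ζ)) (V ζ) (W ζ)) ξ :=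
  CoordGeom.contDiffAt_dot (fun i j => (h.smooth_metric i j).comp ξ h.smooth) hV hW

/-- Metric compatibility. -/
lemma fderiv_dot (h : RegularAt G X ξ) (hV : ContDiffAt ℝ ∞ V ξ) (hW : ContDiffAt ℝ ∞ W ξ)
    (w : F) :
    fderiv ℝ (fun ζ => dot (G (X ζ)) (V ζ) (W ζ)) ξ w
      = dot (G (X ξ)) (nablaAlong G X w V ξ) (W ξ) + dot (G (X ξ)) (V ξ) (nablaAlong G X w W ξ) := by
  have hd {f : F → ℝ} (h : ContDiffAt ℝ ∞ f ξ) : DifferentiableAt ℝ f ξ :=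
    h.differentiableAt (by simp)
  have hGX (i j : ι) : ContDiffAt ℝ ∞ (fun ζ => G (X ζ) i j) ξ :=
    (h.smooth_metric i j).comp ξ h.smooth
  have hV' := contDiffAt_component hV
  have hW' := contDiffAt_component hW
  set Γ : EuclideanSpace ℝ ι → EuclideanSpace ℝ ι := fun B => WithLp.toLp 2 fun μ =>
    ∑ α, ∑ β, christoffel G (X ξ) μ α β * fderiv ℝ X ξ w α * B β with hΓ
  have key (B C : EuclideanSpace ℝ ι) : dot (G (X ξ)) (Γ B) C
      = ∑ ν, ∑ α, ∑ β, christoffelLower G (X ξ) ν α β * fderiv ℝ X ξ w α * B β * C ν := by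
    simp only [dot, hΓ, ← sum_mul_christoffel h.det_ne_zero, Finset.mul_sum, Finset.sum_mul]
    rw [Finset.sum_comm]
    refine Finset.sum_congr rfl fun ν _ => ?_
    rw [Finset.sum_comm]
    refine Finset.sum_congr rfl fun α _ => ?_
    rw [Finset.sum_comm]
    exact Finset.sum_congr rfl fun β _ => Finset.sum_congr rfl fun μ _ => by
      rw [(h.symm (X ξ)).apply]; ring
  have hnabla (U : F → EuclideanSpace ℝ ι) : nablaAlong G X w U ξ = fderiv ℝ U ξ w + Γ (U ξ) := rfl
  rw [hnabla V, hnabla W, dot_comm (h.symm _) (V ξ), dot_add_left, dot_add_left, key, key,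
    dot_comm (h.symm _) (fderiv ℝ W ξ w)]
  simp only [dot]
  rw [fderiv_fun_sum fun μ _ => hd (ContDiffAt.sum fun ν _ => ((hGX μ ν).mul (hV' μ)).mul (hW' ν))]
  simp only [sum_apply]
  have e1 (μ : ι) : fderiv ℝ (fun ζ => ∑ ν, G (X ζ) μ ν * V ζ μ * W ζ ν) ξ w
      = ∑ ν, ((fderiv ℝ (fun ζ => G (X ζ) μ ν) ξ w * V ξ μ + G (X ξ) μ ν * fderiv ℝ V ξ w μ) * W ξ ν
        + G (X ξ) μ ν * V ξ μ * fderiv ℝ W ξ w ν) := by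
    rw [fderiv_sum_mul_apply (fun ν => hd ((hGX μ ν).mul (hV' μ))) fun ν => hd (hW' ν)]
    refine Finset.sum_congr rfl fun ν _ => ?_
    rw [fderiv_component (hW.differentiableAt (by simp)),
      fderiv_fun_mul (hd (hGX μ ν)) (hd (hV' μ))]
    simp only [add_apply, smul_apply, smul_eq_mul, fderiv_component (hV.differentiableAt (by simp))]
    ring
  have e2 (μ ν : ι) : fderiv ℝ (fun ζ => G (X ζ) μ ν) ξ w
      = ∑ α, (christoffelLower G (X ξ) μ α ν + christoffelLower G (X ξ) ν α μ)
        * fderiv ℝ X ξ w α := by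
    rw [fderiv_comp_eq_sum ((h.smooth_metric μ ν).differentiableAt (by simp))
      (h.smooth.differentiableAt (by simp))]
    exact Finset.sum_congr rfl fun α _ => by rw [pderiv_metric h.symm]
  -- The derivative of the metric splits into two Christoffel symbols: one completes the derivative
  -- of `W` to a covariant one, the other that of `V`.
  have k1 : ∑ μ, ∑ ν, ∑ α, christoffelLower G (X ξ) μ α ν * fderiv ℝ X ξ w α * V ξ μ * W ξ ν
      = ∑ ν, ∑ α, ∑ β, christoffelLower G (X ξ) ν α β * fderiv ℝ X ξ w α * W ξ β * V ξ ν := by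
    refine Finset.sum_congr rfl fun μ _ => ?_
    rw [Finset.sum_comm]
    exact Finset.sum_congr rfl fun α _ => Finset.sum_congr rfl fun ν _ => by ring
  have k2 : ∑ μ, ∑ ν, ∑ α, christoffelLower G (X ξ) ν α μ * fderiv ℝ X ξ w α * V ξ μ * W ξ ν
      = ∑ ν, ∑ α, ∑ β, christoffelLower G (X ξ) ν α β * fderiv ℝ X ξ w α * V ξ β * W ξ ν := by
    rw [Finset.sum_comm]
    exact Finset.sum_congr rfl fun ν _ => Finset.sum_comm
  rw [← k1, ← k2]
  simp only [e1, e2, add_mul, Finset.sum_add_distrib, Finset.sum_mul]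
  ring

/-- The Levi-Civita derivative is torsion free. -/
lemma nablaAlong_fderiv_comm (h : RegularAt G X ξ) (v w : F) :
    nablaAlong G X v (fun ζ => fderiv ℝ X ζ w) ξ = nablaAlong G X w (fun ζ => fderiv ℝ X ζ v) ξ := by
  ext μ
  simp only [nablaAlong_apply]
  rw [fderiv_fderiv_comm h.smooth, Finset.sum_comm]
  congr 1
  refine Finset.sum_congr rfl fun i _ => Finset.sum_congr rfl fun j _ => ?_
  rw [christoffel_symm h.symm]; ring

/-- The terms are grouped by their behaviour under a ↔ b: the first two sums are symmetric, the next
two are exchanged, and only the last contributes to the commutator, where it produces the Riemann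
tensor. -/
lemma nablaAlong_nablaAlong_apply (h : RegularAt G X ξ) (hV : ContDiffAt ℝ ∞ V ξ) (a b : F)
    (σ : ι) :
    nablaAlong G X a (nablaAlong G X b V) ξ σ
      = fderiv ℝ (fun ζ => fderiv ℝ V ζ b) ξ a σ
        + ∑ ν, ∑ ρ, christoffel G (X ξ) σ ν ρ * fderiv ℝ (fun ζ => fderiv ℝ X ζ b) ξ a ν * V ξ ρ
        + ∑ ν, ∑ ρ, christoffel G (X ξ) σ ν ρ * fderiv ℝ X ξ b ν * fderiv ℝ V ξ a ρ
        + ∑ ν, ∑ ρ, christoffel G (X ξ) σ ν ρ * fderiv ℝ X ξ a ν * fderiv ℝ V ξ b ρ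
        + ∑ ρ, ∑ μ, ∑ ν, (pderiv μ (fun y => christoffel G y σ ν ρ) (X ξ)
            + ∑ l, christoffel G (X ξ) σ μ l * christoffel G (X ξ) l ν ρ)
          * V ξ ρ * fderiv ℝ X ξ a μ * fderiv ℝ X ξ b ν := by
  have hd {f : F → ℝ} (h : ContDiffAt ℝ ∞ f ξ) : DifferentiableAt ℝ f ξ :=
    h.differentiableAt (by simp)
  have hΓ := h.contDiffAt_christoffel σ
  have hXb := fun ν => contDiffAt_component (contDiffAt_fderiv_apply h.smooth b) ν
  have hV' := contDiffAt_component hV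
  rw [nablaAlong_apply, ← fderiv_component ((h.contDiffAt_nablaAlong hV b).differentiableAt (by simp))]
  have e1 : fderiv ℝ (fun ζ => nablaAlong G X b V ζ σ) ξ a
      = fderiv ℝ (fun ζ => fderiv ℝ V ζ b) ξ a σ
        + ∑ ν, ∑ ρ, ((fderiv ℝ (fun ζ => christoffel G (X ζ) σ ν ρ) ξ a * fderiv ℝ X ξ b ν
          + christoffel G (X ξ) σ ν ρ * fderiv ℝ (fun ζ => fderiv ℝ X ζ b) ξ a ν) * V ξ ρ
          + christoffel G (X ξ) σ ν ρ * fderiv ℝ X ξ b ν * fderiv ℝ V ξ a ρ) := by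
    simp only [nablaAlong_apply]
    have hsum (ν : ι) := hd (ContDiffAt.sum (s := Finset.univ) fun ρ _ =>
      ((hΓ ν ρ).mul (hXb ν)).mul (hV' ρ))
    rw [fderiv_fun_add (hd (contDiffAt_component (contDiffAt_fderiv_apply hV b) σ))
      (DifferentiableAt.fun_sum fun ν _ => hsum ν), fderiv_fun_sum fun ν _ => hsum ν, add_apply,
      fderiv_component ((contDiffAt_fderiv_apply hV b).differentiableAt (by simp)), sum_apply]
    congr 1
    refine Finset.sum_congr rfl fun ν _ => ?_
    rw [fderiv_sum_mul_apply (fun ρ => hd ((hΓ ν ρ).mul (hXb ν))) fun ρ => hd (hV' ρ)]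
    refine Finset.sum_congr rfl fun ρ _ => ?_
    rw [fderiv_fun_mul (hd (hΓ ν ρ)) (hd (hXb ν)),
      fderiv_component (hV.differentiableAt (by simp))]
    simp only [add_apply, smul_apply, smul_eq_mul,
      fderiv_component ((contDiffAt_fderiv_apply h.smooth b).differentiableAt (by simp))]
    ring
  have e2 (ν ρ : ι) : fderiv ℝ (fun ζ => christoffel G (X ζ) σ ν ρ) ξ a
      = ∑ μ, pderiv μ (fun y => christoffel G y σ ν ρ) (X ξ) * fderiv ℝ X ξ a μ :=
    fderiv_comp_eq_sum ((CoordGeom.contDiffAt_christoffel h.smooth_metric h.det_ne_zero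
      σ ν ρ).differentiableAt (by simp)) (h.smooth.differentiableAt (by simp)) a
  have e3 : ∑ ν, ∑ ρ, (∑ μ, pderiv μ (fun y => christoffel G y σ ν ρ) (X ξ) * fderiv ℝ X ξ a μ)
      * fderiv ℝ X ξ b ν * V ξ ρ = ∑ ρ, ∑ μ, ∑ ν, pderiv μ (fun y => christoffel G y σ ν ρ) (X ξ)
      * V ξ ρ * fderiv ℝ X ξ a μ * fderiv ℝ X ξ b ν := by
    simp only [Finset.sum_mul]
    rw [Finset.sum_comm]
    refine Finset.sum_congr rfl fun ρ _ => ?_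
    rw [Finset.sum_comm]
    exact Finset.sum_congr rfl fun _ _ => Finset.sum_congr rfl fun _ _ => by ring
  have e4 : ∑ μ, ∑ l, christoffel G (X ξ) σ μ l * fderiv ℝ X ξ a μ
      * (∑ ν, ∑ ρ, christoffel G (X ξ) l ν ρ * fderiv ℝ X ξ b ν * V ξ ρ)
      = ∑ ρ, ∑ μ, ∑ ν, (∑ l, christoffel G (X ξ) σ μ l * christoffel G (X ξ) l ν ρ)
          * V ξ ρ * fderiv ℝ X ξ a μ * fderiv ℝ X ξ b ν := by
    simp only [Finset.sum_mul, Finset.mul_sum]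
    conv_rhs => rw [Finset.sum_comm]
    refine Finset.sum_congr rfl fun μ _ => ?_
    rw [Finset.sum_comm_cycle]
    refine Finset.sum_congr rfl fun ρ _ => ?_
    rw [Finset.sum_comm]
    exact Finset.sum_congr rfl fun ν _ => Finset.sum_congr rfl fun l _ => by ring
  rw [e1]
  simp only [nablaAlong_apply, e2, mul_add, add_mul, Finset.sum_add_distrib]
  rw [e3, e4]
  ring

/-- The Riemann tensor is the commutator of Levi-Civita derivatives along a map. -/
lemma nablaAlong_commutator (h : RegularAt G X ξ) (hV : ContDiffAt ℝ ∞ V ξ) (a b : F) (σ : ι) :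
    nablaAlong G X a (nablaAlong G X b V) ξ σ - nablaAlong G X b (nablaAlong G X a V) ξ σ
      = ∑ ρ, ∑ μ, ∑ ν, riemannUp G (X ξ) σ ρ μ ν * V ξ ρ * fderiv ℝ X ξ a μ * fderiv ℝ X ξ b ν := by
  have e : ∑ ρ, ∑ μ, ∑ ν, riemannUp G (X ξ) σ ρ μ ν * V ξ ρ * fderiv ℝ X ξ a μ * fderiv ℝ X ξ b ν
      = ∑ ρ, ∑ μ, ∑ ν, (pderiv μ (fun y => christoffel G y σ ν ρ) (X ξ)
            + ∑ l, christoffel G (X ξ) σ μ l * christoffel G (X ξ) l ν ρ)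
          * V ξ ρ * fderiv ℝ X ξ a μ * fderiv ℝ X ξ b ν
        - ∑ ρ, ∑ μ, ∑ ν, (pderiv μ (fun y => christoffel G y σ ν ρ) (X ξ)
            + ∑ l, christoffel G (X ξ) σ μ l * christoffel G (X ξ) l ν ρ)
          * V ξ ρ * fderiv ℝ X ξ b μ * fderiv ℝ X ξ a ν := by
    rw [← Finset.sum_sub_distrib]
    refine Finset.sum_congr rfl fun ρ _ => ?_
    rw [Finset.sum_comm (f := fun μ ν => _ * V ξ ρ * fderiv ℝ X ξ b μ * fderiv ℝ X ξ a ν)]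
    simp only [← Finset.sum_sub_distrib]
    refine Finset.sum_congr rfl fun μ _ => Finset.sum_congr rfl fun ν _ => ?_
    simp only [riemannUp, Finset.sum_sub_distrib]
    ring
  rw [h.nablaAlong_nablaAlong_apply hV, h.nablaAlong_nablaAlong_apply hV, e,
    fderiv_fderiv_comm hV a b, fderiv_fderiv_comm h.smooth a b]
  ring

/-- The curvature contraction in terms of derivatives of scalar products. -/
lemma riemannContract_eq (h : RegularAt G X ξ) (hV : ContDiffAt ℝ ∞ V ξ)
    (hW : ContDiffAt ℝ ∞ W ξ) (a b : F) :
    riemannContract G (X ξ) (W ξ) (V ξ) (fderiv ℝ X ξ a) (fderiv ℝ X ξ b)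
      = fderiv ℝ (fun ζ => dot (G (X ζ)) (W ζ) (nablaAlong G X b V ζ)) ξ a
        - fderiv ℝ (fun ζ => dot (G (X ζ)) (W ζ) (nablaAlong G X a V ζ)) ξ b
        - dot (G (X ξ)) (nablaAlong G X a W ξ) (nablaAlong G X b V ξ)
        + dot (G (X ξ)) (nablaAlong G X b W ξ) (nablaAlong G X a V ξ) := by
  rw [h.fderiv_dot hW (h.contDiffAt_nablaAlong hV b), h.fderiv_dot hW (h.contDiffAt_nablaAlong hV a)]
  have e : riemannContract G (X ξ) (W ξ) (V ξ) (fderiv ℝ X ξ a) (fderiv ℝ X ξ b)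
      = dot (G (X ξ)) (W ξ) (nablaAlong G X a (nablaAlong G X b V) ξ)
        - dot (G (X ξ)) (W ξ) (nablaAlong G X b (nablaAlong G X a V) ξ) := by
    simp only [dot, ← Finset.sum_sub_distrib, ← mul_sub, h.nablaAlong_commutator hV, riemannContract,
      riemann]
    refine Finset.sum_congr rfl fun s _ => ?_
    simp only [Finset.mul_sum, Finset.sum_mul]
    conv_rhs => rw [Finset.sum_comm]
    refine Finset.sum_congr rfl fun r _ => ?_
    conv_rhs => rw [Finset.sum_comm]
    refine Finset.sum_congr rfl fun m _ => ?_
    conv_rhs => rw [Finset.sum_comm]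
    exact Finset.sum_congr rfl fun n _ => Finset.sum_congr rfl fun l _ => by ring
  rw [e]; ring

end RegularAt

end Along

end CoordGeom

/-! ### Passage from the manifold to coordinates: smoothness and scalar products. -/

section

variable {M : Type*} [TopologicalSpace M] [ChartedSpace (EuclideanSpace ℝ (Fin 4)) M]
  [IsManifold (𝓡 4) ∞ M]

/-- Charts and their inverses are smooth only on open sets, where the tangent map and the tangent
map within the set coincide. -/
lemma contMDiffAt_tangentMap_of_isOpen {E E' H H' N N' : Type*}
    [NormedAddCommGroup E] [NormedSpace ℝ E] [NormedAddCommGroup E'] [NormedSpace ℝ E']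
    [TopologicalSpace H] [TopologicalSpace H'] {I : ModelWithCorners ℝ E H}
    {I' : ModelWithCorners ℝ E' H'} [TopologicalSpace N] [ChartedSpace H N] [TopologicalSpace N']
    [ChartedSpace H' N'] [IsManifold I ∞ N] [IsManifold I' ∞ N'] {f : N → N'} {s : Set N}
    (hf : ContMDiffOn I I' ∞ f s) (hs : IsOpen s) {p : TangentBundle I N} (hp : p.1 ∈ s) :
    ContMDiffAt I.tangent I'.tangent ∞ (tangentMap I I' f) p := by
  have h1 : ContMDiffOn I.tangent I'.tangent ∞ (tangentMapWithin I I' f s)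
      (Bundle.TotalSpace.proj ⁻¹' s) := hf.contMDiffOn_tangentMapWithin (by simp) hs.uniqueMDiffOn
  have h2 : IsOpen (Bundle.TotalSpace.proj ⁻¹' s : Set (TangentBundle I N)) :=
    hs.preimage (FiberBundle.continuous_proj E (TangentSpace I))
  have h3 := h1.contMDiffAt (h2.mem_nhds hp)
  refine h3.congr_of_eventuallyEq ?_
  filter_upwards [h2.mem_nhds hp] with q hq
  exact (tangentMapWithin_eq_tangentMap (hs.uniqueMDiffOn q.1 hq)
    ((hf.contMDiffAt (hs.mem_nhds hq)).mdifferentiableAt (by simp))).symm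

lemma LorentzMetric.isSymm_coord (g : LorentzMetric M)
    (φ : OpenPartialHomeomorph M (EuclideanSpace ℝ (Fin 4))) (x : EuclideanSpace ℝ (Fin 4)) :
    (g.coord φ x).IsSymm := by
  ext i j
  exact g.symm _ _ _

lemma LorentzMetric.contDiffAt_coord (g : LorentzMetric M)
    {φ : OpenPartialHomeomorph M (EuclideanSpace ℝ (Fin 4))}
    (hφ : φ ∈ IsManifold.maximalAtlas (𝓡 4) ∞ M) {x : EuclideanSpace ℝ (Fin 4)}
    (hx : x ∈ φ.target) (i j : Fin 4) :
    ContDiffAt ℝ ∞ (fun y => g.coord φ y i j) x := by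
  have hsymm := contMDiffOn_symm_of_mem_maximalAtlas hφ
  have hsec (k : Fin 4) : ContMDiffAt (𝓡 4) (𝓡 4).tangent ∞
      (fun y => (⟨φ.symm y, mfderiv (𝓡 4) (𝓡 4) φ.symm y (EuclideanSpace.single k (1 : ℝ))⟩ :
        TangentBundle (𝓡 4) M)) x := by
    have hc : ContMDiffAt (𝓡 4) (𝓡 4).tangent ∞ (fun y => (⟨y, EuclideanSpace.single k (1 : ℝ)⟩ :
        TangentBundle (𝓡 4) (EuclideanSpace ℝ (Fin 4)))) x :=
      contMDiffAt_vectorSpace_iff_contDiffAt.mpr contDiffAt_const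
    exact (contMDiffAt_tangentMap_of_isOpen hsymm φ.open_target
      (p := ⟨x, EuclideanSpace.single k (1 : ℝ)⟩) hx).comp x hc
  have hφx : ContMDiffAt (𝓡 4) (𝓡 4) ∞ φ.symm x := hsymm.contMDiffAt (φ.open_target.mem_nhds hx)
  have : ContMDiffAt (𝓡 4) ((𝓡 4).prod 𝓘(ℝ)) ∞
      (fun y => Bundle.TotalSpace.mk' ℝ (E := Bundle.Trivial M ℝ) (φ.symm y)
        (g.inner (φ.symm y)
          (mfderiv (𝓡 4) (𝓡 4) φ.symm y (EuclideanSpace.single i (1 : ℝ)))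
          (mfderiv (𝓡 4) (𝓡 4) φ.symm y (EuclideanSpace.single j (1 : ℝ))))) x := by
    apply ContMDiffAt.clm_bundle_apply₂ (F₁ := EuclideanSpace ℝ (Fin 4))
      (F₂ := EuclideanSpace ℝ (Fin 4))
    · exact (g.contMDiff.contMDiffAt).comp x hφx
    · exact hsec i
    · exact hsec j
  rw [Bundle.contMDiffAt_totalSpace] at this
  exact this.2.contDiffAt

/-- The differential of a chart is an isometry onto the coordinate metric; the frame relations of
the hypersurface pass to coordinates through it. -/
lemma LorentzMetric.dot_mfderiv (g : LorentzMetric M)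
    {φ : OpenPartialHomeomorph M (EuclideanSpace ℝ (Fin 4))}
    (hφ : φ ∈ IsManifold.maximalAtlas (𝓡 4) ∞ M) {p : M} (hp : p ∈ φ.source)
    (u v : TangentSpace (𝓡 4) p) :
    CoordGeom.dot (g.coord φ (φ p)) (mfderiv (𝓡 4) (𝓡 4) φ p u) (mfderiv (𝓡 4) (𝓡 4) φ p v)
      = g.inner p u v := by
  have hd : φ.MDifferentiable (𝓡 4) (𝓡 4) :=
    ⟨(contMDiffOn_of_mem_maximalAtlas hφ).mdifferentiableOn (by simp),
      (contMDiffOn_symm_of_mem_maximalAtlas hφ).mdifferentiableOn (by simp)⟩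
  have hinv (w : TangentSpace (𝓡 4) p) :
      mfderiv (𝓡 4) (𝓡 4) φ.symm (φ p) (mfderiv (𝓡 4) (𝓡 4) φ p w) = w :=
    congrArg (fun T => T w) (hd.symm_comp_deriv hp)
  -- The base points φ⁻¹(φ(p)) and p are equal only propositionally; all tangent spaces are the same
  -- model space, so the two scalar products can be compared on the same vectors.
  have hpt : ∀ q, q = p → ∀ a b : EuclideanSpace ℝ (Fin 4), g.inner q a b = g.inner p a b := by
    rintro q rfl a b; rfl
  have hsum (T : EuclideanSpace ℝ (Fin 4) →L[ℝ] EuclideanSpace ℝ (Fin 4))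
      (B : EuclideanSpace ℝ (Fin 4) →L[ℝ] EuclideanSpace ℝ (Fin 4) →L[ℝ] ℝ)
      (a b : EuclideanSpace ℝ (Fin 4)) :
      ∑ i, ∑ j, B (T (EuclideanSpace.single i 1)) (T (EuclideanSpace.single j 1)) * a i * b j
        = B (T a) (T b) := by
    have h2 (u : EuclideanSpace ℝ (Fin 4)) : u = ∑ μ, u μ • EuclideanSpace.single μ (1 : ℝ) := by
      ext i; simp [Finset.sum_apply, Pi.single_apply]
    conv_rhs => rw [h2 a, h2 b]
    simp only [map_sum, map_smul, sum_apply, smul_apply, smul_eq_mul, Finset.mul_sum]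
    conv_rhs => rw [Finset.sum_comm]
    exact Finset.sum_congr rfl fun i _ => Finset.sum_congr rfl fun j _ => by ring
  refine (hsum (mfderiv (𝓡 4) (𝓡 4) φ.symm (φ p)) (g.inner (φ.symm (φ p)))
    (mfderiv (𝓡 4) (𝓡 4) φ p u) (mfderiv (𝓡 4) (𝓡 4) φ p v)).trans ?_
  refine (hpt _ (φ.left_inv hp) _ _).trans ?_
  exact congrArg₂ (fun a b => g.inner p a b) (hinv u) (hinv v)

namespace NullHypersurface

variable {g : LorentzMetric M} (H : NullHypersurface g)
  {φ : OpenPartialHomeomorph M (EuclideanSpace ℝ (Fin 4))}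
  {ψ : OpenPartialHomeomorph TwoSphere (EuclideanSpace ℝ (Fin 2))}
  {ξ : ℝ × EuclideanSpace ℝ (Fin 2)}

lemma contMDiffAt_param (hψ : ψ ∈ IsManifold.maximalAtlas (𝓡 2) ∞ TwoSphere) (hξ : ξ.2 ∈ ψ.target) :
    ContMDiffAt 𝓘(ℝ, ℝ × EuclideanSpace ℝ (Fin 2)) (𝓘(ℝ, ℝ).prod (𝓡 2)) ∞
      (fun ζ : ℝ × EuclideanSpace ℝ (Fin 2) => (ζ.1, ψ.symm ζ.2)) ξ := by
  have h1 := (contMDiffOn_symm_of_mem_maximalAtlas hψ).contMDiffAt (ψ.open_target.mem_nhds hξ)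
  refine ContMDiffAt.prodMk contDiff_fst.contDiffAt.contMDiffAt ?_
  exact ContMDiffAt.comp (I' := 𝓡 2) ξ h1 (contDiff_snd.contDiffAt.contMDiffAt)

lemma contMDiffAt_point (hψ : ψ ∈ IsManifold.maximalAtlas (𝓡 2) ∞ TwoSphere) (hξ : ξ.2 ∈ ψ.target) :
    ContMDiffAt 𝓘(ℝ, ℝ × EuclideanSpace ℝ (Fin 2)) (𝓡 4) ∞ (H.point ψ) ξ :=
  ContMDiffAt.comp ξ (H.isSmoothEmbedding.contMDiff.contMDiffAt) (contMDiffAt_param hψ hξ)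

lemma contDiffAt_embed (hφ : φ ∈ IsManifold.maximalAtlas (𝓡 4) ∞ M)
    (hψ : ψ ∈ IsManifold.maximalAtlas (𝓡 2) ∞ TwoSphere)
    (hξ : ξ.2 ∈ ψ.target) (hξφ : H.point ψ ξ ∈ φ.source) :
    ContDiffAt ℝ ∞ (H.embed φ ψ) ξ := by
  rw [← contMDiffAt_iff_contDiffAt]
  exact ContMDiffAt.comp ξ (contMDiffAt_of_mem_maximalAtlas hφ hξφ) (H.contMDiffAt_point hψ hξ)

/-- The rigging is a smooth map into the tangent bundle; composing with the tangent map of the chart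
and taking the fibre component gives its coordinate form. -/
lemma contDiffAt_rigging (hφ : φ ∈ IsManifold.maximalAtlas (𝓡 4) ∞ M)
    (hψ : ψ ∈ IsManifold.maximalAtlas (𝓡 2) ∞ TwoSphere)
    (hξ : ξ.2 ∈ ψ.target) (hξφ : H.point ψ ξ ∈ φ.source) :
    ContDiffAt ℝ ∞ (H.rigging φ ψ) ξ := by
  have h1 : ContMDiffAt 𝓘(ℝ, ℝ × EuclideanSpace ℝ (Fin 2)) (𝓡 4).tangent ∞
      (fun ζ : ℝ × EuclideanSpace ℝ (Fin 2) =>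
        (⟨H.point ψ ζ, H.ell (ζ.1, ψ.symm ζ.2)⟩ : TangentBundle (𝓡 4) M)) ξ :=
    ContMDiffAt.comp ξ H.ell_smooth.contMDiffAt (contMDiffAt_param hψ hξ)
  have h2 := (contMDiffAt_tangentMap_of_isOpen (contMDiffOn_of_mem_maximalAtlas hφ) φ.open_source
    (p := ⟨H.point ψ ξ, H.ell (ξ.1, ψ.symm ξ.2)⟩) hξφ).comp ξ h1
  exact contMDiffAt_iff_contDiffAt.mp
    ((contMDiff_snd_tangentBundle_modelSpace _ (𝓡 4)).contMDiffAt.comp ξ h2)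

lemma eventually_mem (hψ : ψ ∈ IsManifold.maximalAtlas (𝓡 2) ∞ TwoSphere)
    (hξ : ξ.2 ∈ ψ.target) (hξφ : H.point ψ ξ ∈ φ.source) :
    ∀ᶠ ζ in nhds ξ, ζ.2 ∈ ψ.target ∧ H.point ψ ζ ∈ φ.source :=
  (continuousAt_snd.eventually (ψ.open_target.mem_nhds hξ)).and
    ((H.contMDiffAt_point hψ hξ).continuousAt.eventually (φ.open_source.mem_nhds hξφ))

/-- The derivative of the coordinate expression of the embedding. -/
lemma fderiv_embed_apply (hφ : φ ∈ IsManifold.maximalAtlas (𝓡 4) ∞ M)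
    (hψ : ψ ∈ IsManifold.maximalAtlas (𝓡 2) ∞ TwoSphere)
    (hξ : ξ.2 ∈ ψ.target) (hξφ : H.point ψ ξ ∈ φ.source) (t : ℝ) (v : EuclideanSpace ℝ (Fin 2)) :
    fderiv ℝ (H.embed φ ψ) ξ (t, v) = mfderiv (𝓡 4) (𝓡 4) φ (H.point ψ ξ)
      (mfderiv (𝓘(ℝ, ℝ).prod (𝓡 2)) (𝓡 4) H.Φ (ξ.1, ψ.symm ξ.2)
        (t, mfderiv (𝓡 2) (𝓡 2) ψ.symm ξ.2 v)) := by
  have h1 := (contMDiffOn_symm_of_mem_maximalAtlas hψ).contMDiffAt (ψ.open_target.mem_nhds hξ)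
  have hφd := (contMDiffAt_of_mem_maximalAtlas hφ hξφ).mdifferentiableAt (n := ∞) (by simp)
  have hΦ := (H.isSmoothEmbedding.contMDiff.contMDiffAt (x := (ξ.1, ψ.symm ξ.2))).mdifferentiableAt
    (n := ∞) (by simp)
  have hpt := (H.contMDiffAt_point hψ hξ).mdifferentiableAt (n := ∞) (by simp)
  have hpar := (contMDiffAt_param hψ hξ).mdifferentiableAt (n := ∞) (by simp)
  have e1 : mfderiv 𝓘(ℝ, ℝ × EuclideanSpace ℝ (Fin 2)) (𝓡 4) (H.embed φ ψ) ξ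
      = (mfderiv (𝓡 4) (𝓡 4) φ (H.point ψ ξ)).comp
        (mfderiv 𝓘(ℝ, ℝ × EuclideanSpace ℝ (Fin 2)) (𝓡 4) (H.point ψ) ξ) :=
    mfderiv_comp ξ hφd hpt
  have e2 : mfderiv 𝓘(ℝ, ℝ × EuclideanSpace ℝ (Fin 2)) (𝓡 4) (H.point ψ) ξ
      = (mfderiv (𝓘(ℝ, ℝ).prod (𝓡 2)) (𝓡 4) H.Φ (ξ.1, ψ.symm ξ.2)).comp
        (mfderiv 𝓘(ℝ, ℝ × EuclideanSpace ℝ (Fin 2)) (𝓘(ℝ, ℝ).prod (𝓡 2))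
          (fun ζ : ℝ × EuclideanSpace ℝ (Fin 2) => (ζ.1, ψ.symm ζ.2)) ξ) :=
    mfderiv_comp ξ hΦ hpar
  have hfst : HasMFDerivAt 𝓘(ℝ, ℝ × EuclideanSpace ℝ (Fin 2)) 𝓘(ℝ, ℝ) Prod.fst ξ
      (ContinuousLinearMap.fst ℝ ℝ (EuclideanSpace ℝ (Fin 2))) :=
    (hasFDerivAt_fst (𝕜 := ℝ) (p := ξ)).hasMFDerivAt
  have hsnd : HasMFDerivAt 𝓘(ℝ, ℝ × EuclideanSpace ℝ (Fin 2)) (𝓡 2) Prod.snd ξ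
      (ContinuousLinearMap.snd ℝ ℝ (EuclideanSpace ℝ (Fin 2))) :=
    (hasFDerivAt_snd (𝕜 := ℝ) (p := ξ)).hasMFDerivAt
  have e3 := (hfst.prodMk
    ((h1.mdifferentiableAt (by simp)).hasMFDerivAt.comp (I' := 𝓡 2) ξ hsnd)).mfderiv
  have e4 := congrArg (fun T => T (t, v)) (e1.trans (congrArg _ (e2.trans (congrArg _ e3))))
  rw [← mfderiv_eq_fderiv]
  exact e4

lemma dot_normal_tangent (hφ : φ ∈ IsManifold.maximalAtlas (𝓡 4) ∞ M)
    (hψ : ψ ∈ IsManifold.maximalAtlas (𝓡 2) ∞ TwoSphere)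
    (hξ : ξ.2 ∈ ψ.target) (hξφ : H.point ψ ξ ∈ φ.source) (t : ℝ) (v : EuclideanSpace ℝ (Fin 2)) :
    CoordGeom.dot (g.coord φ (H.embed φ ψ ξ)) (H.normal φ ψ ξ) (fderiv ℝ (H.embed φ ψ) ξ (t, v))
      = 0 := by
  have e : fderiv ℝ (H.embed φ ψ) ξ (1, 0) = mfderiv (𝓡 4) (𝓡 4) φ (H.point ψ ξ)
      (mfderiv (𝓘(ℝ, ℝ).prod (𝓡 2)) (𝓡 4) H.Φ (ξ.1, ψ.symm ξ.2)
        ((1 : ℝ), (0 : EuclideanSpace ℝ (Fin 2)))) :=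
    (H.fderiv_embed_apply hφ hψ hξ hξφ 1 0).trans <|
      congrArg (fun w : EuclideanSpace ℝ (Fin 2) => mfderiv (𝓡 4) (𝓡 4) φ (H.point ψ ξ)
        (mfderiv (𝓘(ℝ, ℝ).prod (𝓡 2)) (𝓡 4) H.Φ (ξ.1, ψ.symm ξ.2) ((1 : ℝ), w)))
        (map_zero (mfderiv (𝓡 2) (𝓡 2) ψ.symm ξ.2))
  rw [normal, e, H.fderiv_embed_apply hφ hψ hξ hξφ]
  exact (g.dot_mfderiv hφ hξφ _ _).trans (H.normal_orthogonal _ _)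

lemma dot_rigging_tangent (hφ : φ ∈ IsManifold.maximalAtlas (𝓡 4) ∞ M)
    (hψ : ψ ∈ IsManifold.maximalAtlas (𝓡 2) ∞ TwoSphere)
    (hξ : ξ.2 ∈ ψ.target) (hξφ : H.point ψ ξ ∈ φ.source) (t : ℝ) (v : EuclideanSpace ℝ (Fin 2)) :
    CoordGeom.dot (g.coord φ (H.embed φ ψ ξ)) (H.rigging φ ψ ξ) (fderiv ℝ (H.embed φ ψ) ξ (t, v))
      = t := by
  rw [H.fderiv_embed_apply hφ hψ hξ hξφ]
  exact (g.dot_mfderiv hφ hξφ _ _).trans (H.ell_tangent _ _ _)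

lemma dot_rigging_rigging (hφ : φ ∈ IsManifold.maximalAtlas (𝓡 4) ∞ M)
    (hξφ : H.point ψ ξ ∈ φ.source) :
    CoordGeom.dot (g.coord φ (H.embed φ ψ ξ)) (H.rigging φ ψ ξ) (H.rigging φ ψ ξ) = 0 :=
  (g.dot_mfderiv hφ hξφ _ _).trans (H.ell_null _)

end NullHypersurface
end

/-! ### Linear algebra of null frames. -/

namespace CoordGeom

variable {ι : Type*} [Fintype ι] [DecidableEq ι]

section NullFrame

variable {G : EuclideanSpace ℝ (Fin 4) → Matrix (Fin 4) (Fin 4) ℝ} {x : EuclideanSpace ℝ (Fin 4)}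

/-- `n, ℓ, e 0, e 1` is a frame adapted to a null hyperplane with respect to `A`. -/
structure IsNullFrame (A : Matrix (Fin 4) (Fin 4) ℝ) (n l : EuclideanSpace ℝ (Fin 4))
    (e : Fin 2 → EuclideanSpace ℝ (Fin 4)) : Prop where
  symm : A.IsSymm
  nn : dot A n n = 0
  ne : ∀ a, dot A n (e a) = 0
  ln : dot A l n = 1
  ll : dot A l l = 0
  le : ∀ a, dot A l (e a) = 0
  pos : 0 < dot A (e 0) (e 0)
  det_pos : 0 < dot A (e 0) (e 0) * dot A (e 1) (e 1) - dot A (e 0) (e 1) ^ 2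

namespace IsNullFrame

variable {A : Matrix (Fin 4) (Fin 4) ℝ} {n l : EuclideanSpace ℝ (Fin 4)}
    {e : Fin 2 → EuclideanSpace ℝ (Fin 4)}

/-- The Gram matrix is block diagonal: a hyperbolic block for `n`, `l`, which is its own inverse,
and the 2 × 2 block q, inverted by adjugate over determinant. -/
lemma gram_mul (h : IsNullFrame A n l e) :
    Matrix.of (fun I J => dot A (![n, l, e 0, e 1] I) (![n, l, e 0, e 1] J)) *
      !![0, 1, 0, 0; 1, 0, 0, 0;
        0, 0, dot A (e 1) (e 1) / (dot A (e 0) (e 0) * dot A (e 1) (e 1) - dot A (e 0) (e 1) ^ 2),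
          -dot A (e 0) (e 1) / (dot A (e 0) (e 0) * dot A (e 1) (e 1) - dot A (e 0) (e 1) ^ 2);
        0, 0, -dot A (e 0) (e 1) / (dot A (e 0) (e 0) * dot A (e 1) (e 1) - dot A (e 0) (e 1) ^ 2),
          dot A (e 0) (e 0) / (dot A (e 0) (e 0) * dot A (e 1) (e 1) - dot A (e 0) (e 1) ^ 2)]
      = 1 := by
  have hd := h.det_pos.ne'
  have h1 := h.nn
  have h2 := h.ll
  have h3 := h.ln
  have h4 := h.ne 0
  have h5 := h.ne 1
  have h6 := h.le 0
  have h7 := h.le 1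
  have c1 := dot_comm h.symm n l
  have c2 := dot_comm h.symm (e 0) n
  have c3 := dot_comm h.symm (e 1) n
  have c4 := dot_comm h.symm (e 0) l
  have c5 := dot_comm h.symm (e 1) l
  have c6 := dot_comm h.symm (e 1) (e 0)
  rw [h3] at c1; rw [h4] at c2; rw [h5] at c3; rw [h6] at c4; rw [h7] at c5
  ext I J
  fin_cases I <;> fin_cases J <;>
    simp [Matrix.mul_apply, Fin.sum_univ_four, h1, h2, h3, h4, h5, h6, h7, c1, c2, c3, c4, c5,
      c6] <;> field_simp <;> ring

lemma det_ne_zero (h : IsNullFrame A n l e) : A.det ≠ 0 := det_ne_zero_of_frame h.gram_mul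

lemma dot_eq (h : IsNullFrame A n l e) (u v : EuclideanSpace ℝ (Fin 4)) :
    dot A u v = dot A u n * dot A v l + dot A u l * dot A v n
      + (dot A (e 1) (e 1) * dot A u (e 0) * dot A v (e 0)
        - dot A (e 0) (e 1) * (dot A u (e 0) * dot A v (e 1) + dot A u (e 1) * dot A v (e 0))
        + dot A (e 0) (e 0) * dot A u (e 1) * dot A v (e 1))
      / (dot A (e 0) (e 0) * dot A (e 1) (e 1) - dot A (e 0) (e 1) ^ 2) := by
  rw [dot_eq_sum_frame h.symm h.gram_mul u v]
  simp [Fin.sum_univ_four]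
  ring

lemma ricciContract_eq (h : IsNullFrame (G x) n l e) (Y Z : EuclideanSpace ℝ (Fin 4)) :
    ricciContract G x Y Z = riemannContract G x n Y l Z + riemannContract G x l Y n Z
      + (dot (G x) (e 1) (e 1) * riemannContract G x (e 0) Y (e 0) Z
        - dot (G x) (e 0) (e 1) *
          (riemannContract G x (e 0) Y (e 1) Z + riemannContract G x (e 1) Y (e 0) Z)
        + dot (G x) (e 0) (e 0) * riemannContract G x (e 1) Y (e 1) Z)
      / (dot (G x) (e 0) (e 0) * dot (G x) (e 1) (e 1) - dot (G x) (e 0) (e 1) ^ 2) := by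
  rw [ricciContract_eq_sum_frame h.gram_mul Y Z]
  simp [Fin.sum_univ_four]
  ring

end IsNullFrame

lemma riemannContract_self_right (A B C : EuclideanSpace ℝ (Fin 4)) :
    riemannContract G x A B C C = 0 := by
  linarith [riemannContract_antisymm_right (G := G) (x := x) A B C C]

lemma riemannContract_self_left (hG : ∀ y, (G y).IsSymm)
    (hs : ∀ i j, ContDiffAt ℝ ∞ (fun y => G y i j) x) (hdet : (G x).det ≠ 0)
    (A C D : EuclideanSpace ℝ (Fin 4)) :
    riemannContract G x A A C D = 0 := by
  linarith [riemannContract_antisymm_left hG hs hdet A A C D]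

/-- A symmetric `2 × 2` form with vanishing determinant and vanishing trace with respect to a
positive definite form is zero. -/
lemma eq_zero_of_trace_det {q00 q01 q11 t00 t01 t11 : ℝ} (hq : 0 < q00)
    (hd : 0 < q00 * q11 - q01 ^ 2) (htr : q11 * t00 + q00 * t11 - 2 * q01 * t01 = 0)
    (hdet : t00 * t11 - t01 ^ 2 = 0) : t00 = 0 ∧ t01 = 0 ∧ t11 = 0 := by
  -- Eliminating t11 between trace and determinant leaves a sum of two nonnegative terms.
  have h1 : (q00 * q11 - q01 ^ 2) * t00 ^ 2 + (q01 * t00 - q00 * t01) ^ 2 = 0 := by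
    linear_combination q00 * t00 * htr - q00 ^ 2 * hdet
  have h2 : t00 = 0 := by
    have : (q00 * q11 - q01 ^ 2) * t00 ^ 2 = 0 :=
      le_antisymm (by nlinarith [sq_nonneg (q01 * t00 - q00 * t01)]) (by positivity)
    rcases mul_eq_zero.mp this with h | h
    · exact absurd h hd.ne'
    · exact pow_eq_zero_iff two_ne_zero |>.mp h
  subst h2
  have h3 : t01 = 0 := by
    have : t01 ^ 2 = 0 := by linarith
    exact pow_eq_zero_iff two_ne_zero |>.mp this
  subst h3
  refine ⟨rfl, rfl, ?_⟩
  have : q00 * t11 = 0 := by linarith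
  exact (mul_eq_zero.mp this).resolve_left hq.ne'

end NullFrame

/-! ### Connection coefficients of the horizon frame, and Raychaudhuri's equation. -/

section Horizon

variable {G : EuclideanSpace ℝ (Fin 4) → Matrix (Fin 4) (Fin 4) ℝ}
  {X L : ℝ × EuclideanSpace ℝ (Fin 2) → EuclideanSpace ℝ (Fin 4)}
  {ξ : ℝ × EuclideanSpace ℝ (Fin 2)}

/-- The coordinate direction `∂/∂ξ^A`. -/
noncomputable def dir (A : Fin 2) : ℝ × EuclideanSpace ℝ (Fin 2) := (0, EuclideanSpace.single A 1)

/-- The vector field `∂X/∂ξ¹`. -/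
noncomputable def tangentOne (X : ℝ × EuclideanSpace ℝ (Fin 2) → EuclideanSpace ℝ (Fin 4))
    (ζ : ℝ × EuclideanSpace ℝ (Fin 2)) : EuclideanSpace ℝ (Fin 4) :=
  fderiv ℝ X ζ (1, 0)

/-- The vector field `∂X/∂ξ^A`. -/
noncomputable def tangent (X : ℝ × EuclideanSpace ℝ (Fin 2) → EuclideanSpace ℝ (Fin 4))
    (A : Fin 2) (ζ : ℝ × EuclideanSpace ℝ (Fin 2)) : EuclideanSpace ℝ (Fin 4) :=
  fderiv ℝ X ζ (dir A)

/-- The second fundamental form `g(∇_A n, e_B)`. -/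
noncomputable def secondForm (G : EuclideanSpace ℝ (Fin 4) → Matrix (Fin 4) (Fin 4) ℝ)
    (X : ℝ × EuclideanSpace ℝ (Fin 2) → EuclideanSpace ℝ (Fin 4)) (A B : Fin 2)
    (ζ : ℝ × EuclideanSpace ℝ (Fin 2)) : ℝ :=
  dot (G (X ζ)) (nablaAlong G X (dir A) (tangentOne X) ζ) (tangent X B ζ)

/-- `X` parametrises a null hypersurface with rigging `L`, and at `ζ` the expansion and the Ricci
tensor vanish. -/
structure HorizonAt (G : EuclideanSpace ℝ (Fin 4) → Matrix (Fin 4) (Fin 4) ℝ)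
    (X L : ℝ × EuclideanSpace ℝ (Fin 2) → EuclideanSpace ℝ (Fin 4))
    (ζ : ℝ × EuclideanSpace ℝ (Fin 2)) : Prop where
  regular : RegularAt G X ζ
  smooth_rigging : ContDiffAt ℝ ∞ L ζ
  frame : IsNullFrame (G (X ζ)) (tangentOne X ζ) (L ζ) fun A => tangent X A ζ
  ricci : ∀ Y Z, ricciContract G (X ζ) Y Z = 0
  expansion : dot (G (X ζ)) (tangent X 1 ζ) (tangent X 1 ζ) * secondForm G X 0 0 ζ
    + dot (G (X ζ)) (tangent X 0 ζ) (tangent X 0 ζ) * secondForm G X 1 1 ζ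
    - dot (G (X ζ)) (tangent X 0 ζ) (tangent X 1 ζ)
      * (secondForm G X 0 1 ζ + secondForm G X 1 0 ζ) = 0

lemma RegularAt.smooth_tangentOne (h : RegularAt G X ξ) : ContDiffAt ℝ ∞ (tangentOne X) ξ :=
  contDiffAt_fderiv_apply h.smooth _

lemma RegularAt.smooth_tangent (h : RegularAt G X ξ) (A : Fin 2) : ContDiffAt ℝ ∞ (tangent X A) ξ :=
  contDiffAt_fderiv_apply h.smooth _

/-- The scalar products of the frame involving `n` or `ℓ` are constant near the point;
differentiating them gives all the antisymmetry relations between the connection coefficients below.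
-/
lemma RegularAt.dot_nabla_of_eventually_const {V W : ℝ × EuclideanSpace ℝ (Fin 2) → EuclideanSpace ℝ (Fin 4)}
    (h : RegularAt G X ξ) (hV : ContDiffAt ℝ ∞ V ξ) (hW : ContDiffAt ℝ ∞ W ξ) {c : ℝ}
    (hc : ∀ᶠ ζ in nhds ξ, dot (G (X ζ)) (V ζ) (W ζ) = c) (w : ℝ × EuclideanSpace ℝ (Fin 2)) :
    dot (G (X ξ)) (nablaAlong G X w V ξ) (W ξ) + dot (G (X ξ)) (nablaAlong G X w W ξ) (V ξ) = 0 := by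
  rw [dot_comm (h.symm _) (nablaAlong G X w W ξ), ← h.fderiv_dot hV hW]
  have : (fun ζ => dot (G (X ζ)) (V ζ) (W ζ)) =ᶠ[nhds ξ] fun _ => c := hc
  rw [this.fderiv_eq]; simp

lemma dot_nabla_one_one (h : ∀ᶠ ζ in nhds ξ, HorizonAt G X L ζ)
    (w : ℝ × EuclideanSpace ℝ (Fin 2)) :
    dot (G (X ξ)) (nablaAlong G X w (tangentOne X) ξ) (tangentOne X ξ) = 0 := by
  have h0 := h.self_of_nhds.regular
  linarith [h0.dot_nabla_of_eventually_const h0.smooth_tangentOne h0.smooth_tangentOne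
    (h.mono fun ζ hζ => hζ.frame.nn) w]

lemma dot_nabla_tangent_one (h : ∀ᶠ ζ in nhds ξ, HorizonAt G X L ζ)
    (w : ℝ × EuclideanSpace ℝ (Fin 2)) (A : Fin 2) :
    dot (G (X ξ)) (nablaAlong G X w (tangent X A) ξ) (tangentOne X ξ)
      = -dot (G (X ξ)) (nablaAlong G X w (tangentOne X) ξ) (tangent X A ξ) := by
  have h0 := h.self_of_nhds.regular
  linarith [h0.dot_nabla_of_eventually_const h0.smooth_tangentOne (h0.smooth_tangent A)
    (h.mono fun ζ hζ => hζ.frame.ne A) w]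

lemma dot_nabla_rigging_one (h : ∀ᶠ ζ in nhds ξ, HorizonAt G X L ζ)
    (w : ℝ × EuclideanSpace ℝ (Fin 2)) :
    dot (G (X ξ)) (nablaAlong G X w L ξ) (tangentOne X ξ)
      = -dot (G (X ξ)) (nablaAlong G X w (tangentOne X) ξ) (L ξ) := by
  have h0 := h.self_of_nhds
  linarith [h0.regular.dot_nabla_of_eventually_const h0.smooth_rigging h0.regular.smooth_tangentOne
    (h.mono fun ζ hζ => hζ.frame.ln) w]

lemma dot_nabla_tangent_rigging (h : ∀ᶠ ζ in nhds ξ, HorizonAt G X L ζ)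
    (w : ℝ × EuclideanSpace ℝ (Fin 2)) (A : Fin 2) :
    dot (G (X ξ)) (nablaAlong G X w (tangent X A) ξ) (L ξ)
      = -dot (G (X ξ)) (nablaAlong G X w L ξ) (tangent X A ξ) := by
  have h0 := h.self_of_nhds
  linarith [h0.regular.dot_nabla_of_eventually_const h0.smooth_rigging (h0.regular.smooth_tangent A)
    (h.mono fun ζ hζ => hζ.frame.le A) w]

lemma RegularAt.nabla_one_tangent (h : RegularAt G X ξ) (A : Fin 2) :
    nablaAlong G X (1, 0) (tangent X A) ξ = nablaAlong G X (dir A) (tangentOne X) ξ :=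
  h.nablaAlong_fderiv_comm _ _

lemma RegularAt.nabla_tangent_comm (h : RegularAt G X ξ) (A B : Fin 2) :
    nablaAlong G X (dir A) (tangent X B) ξ = nablaAlong G X (dir B) (tangent X A) ξ :=
  h.nablaAlong_fderiv_comm _ _

/-- The integral curves of the null normal are geodesics. -/
lemma dot_nabla_one_one_tangent (h : ∀ᶠ ζ in nhds ξ, HorizonAt G X L ζ)
    (A : Fin 2) :
    dot (G (X ξ)) (nablaAlong G X (1, 0) (tangentOne X) ξ) (tangent X A ξ) = 0 := by
  have h1 := dot_nabla_tangent_one h (1, 0) A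
  -- Torsion-freeness gives ∇_n e_A = ∇_A n, which is orthogonal to n because n is null.
  rw [h.self_of_nhds.regular.nabla_one_tangent, dot_nabla_one_one h] at h1
  linarith

/-- Θ_AB = -g(∇_A e_B, n), and ∇_A e_B is symmetric in A and B. -/
lemma secondForm_symm (h : ∀ᶠ ζ in nhds ξ, HorizonAt G X L ζ)
    (A B : Fin 2) : secondForm G X A B ξ = secondForm G X B A ξ := by
  have h1 := dot_nabla_tangent_one h (dir A) B
  have h2 := dot_nabla_tangent_one h (dir B) A
  rw [h.self_of_nhds.regular.nabla_tangent_comm] at h1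
  simp only [secondForm]
  linarith

lemma expansion_eq_zero (h : ∀ᶠ ζ in nhds ξ, HorizonAt G X L ζ) :
    dot (G (X ξ)) (tangent X 1 ξ) (tangent X 1 ξ) * secondForm G X 0 0 ξ
      + dot (G (X ξ)) (tangent X 0 ξ) (tangent X 0 ξ) * secondForm G X 1 1 ξ
      - 2 * dot (G (X ξ)) (tangent X 0 ξ) (tangent X 1 ξ) * secondForm G X 0 1 ξ = 0 := by
  have := h.self_of_nhds.expansion
  rw [secondForm_symm h 1 0] at this
  linarith

lemma smooth_secondForm (h : ∀ᶠ ζ in nhds ξ, HorizonAt G X L ζ)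
    (A B : Fin 2) : ContDiffAt ℝ ∞ (secondForm G X A B) ξ := by
  have h0 := h.self_of_nhds.regular
  exact h0.contDiffAt_dot (h0.contDiffAt_nablaAlong h0.smooth_tangentOne _) (h0.smooth_tangent B)

/-- The components `R(e_B, n, e_A, n)` of the Riemann tensor. -/
lemma riemannContract_tangent_one (h : ∀ᶠ ζ in nhds ξ, HorizonAt G X L ζ)
    (A B : Fin 2) :
    riemannContract G (X ξ) (tangent X B ξ) (tangentOne X ξ) (tangent X A ξ) (tangentOne X ξ)
      = -fderiv ℝ (secondForm G X A B) ξ (1, 0)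
        + dot (G (X ξ)) (nablaAlong G X (1, 0) (tangentOne X) ξ) (L ξ) * secondForm G X A B ξ
        + dot (G (X ξ)) (nablaAlong G X (dir B) (tangentOne X) ξ)
          (nablaAlong G X (dir A) (tangentOne X) ξ) := by
  have h0 := h.self_of_nhds.regular
  have e := h0.riemannContract_eq h0.smooth_tangentOne (h0.smooth_tangent B) (dir A) (1, 0)
  have e1 : (fun ζ => dot (G (X ζ)) (tangent X B ζ) (nablaAlong G X (1, 0) (tangentOne X) ζ))
      =ᶠ[nhds ξ] fun _ => 0 := h.eventually_nhds.mono fun ζ hζ =>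
    (dot_comm (h0.symm _) _ _).trans (dot_nabla_one_one_tangent hζ B)
  have e2 : (fun ζ => dot (G (X ζ)) (tangent X B ζ) (nablaAlong G X (dir A) (tangentOne X) ζ))
      = secondForm G X A B := funext fun ζ => dot_comm (h0.symm _) _ _
  -- Here ∇_n n = κ n with κ = g(∇_n n, ℓ), so this product is κ g(∇_A e_B, n) = -κ Θ_AB.
  have e3 := h.self_of_nhds.frame.dot_eq (nablaAlong G X (dir A) (tangent X B) ξ)
    (nablaAlong G X (1, 0) (tangentOne X) ξ)
  simp only [dot_nabla_one_one h, dot_nabla_one_one_tangent h, dot_nabla_tangent_one h] at e3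
  rw [e1.fderiv_eq, e2, e3, h0.nabla_one_tangent] at e
  refine e.trans ?_
  simp only [secondForm, fderiv_fun_const]
  simp
  ring

/-- A non-expanding horizon in vacuum is totally geodesic (Raychaudhuri's equation). -/
lemma secondForm_eq_zero (h : ∀ᶠ ζ in nhds ξ, HorizonAt G X L ζ)
    (A B : Fin 2) : secondForm G X A B ξ = 0 := by
  have h0 := h.self_of_nhds
  have hr := h0.regular
  have hd {f : ℝ × EuclideanSpace ℝ (Fin 2) → ℝ} (h : ContDiffAt ℝ ∞ f ξ) :
    DifferentiableAt ℝ f ξ := h.differentiableAt (by simp)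
  have hq (A B : Fin 2) := hr.contDiffAt_dot (hr.smooth_tangent A) (hr.smooth_tangent B)
  have hΘ := smooth_secondForm h
  have dq (A B : Fin 2) : fderiv ℝ (fun ζ => dot (G (X ζ)) (tangent X A ζ) (tangent X B ζ)) ξ (1, 0)
      = 2 * secondForm G X A B ξ := by
    rw [hr.fderiv_dot (hr.smooth_tangent A) (hr.smooth_tangent B), hr.nabla_one_tangent,
      hr.nabla_one_tangent, dot_comm (hr.symm _) (tangent X A ξ), two_mul]
    exact congrArg _ (secondForm_symm h B A)
  -- The trace is taken with the adjugate of q instead of its inverse, so no derivative of the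
  -- determinant of q appears.
  have hF : fderiv ℝ (fun ζ => dot (G (X ζ)) (tangent X 1 ζ) (tangent X 1 ζ) * secondForm G X 0 0 ζ
    + dot (G (X ζ)) (tangent X 0 ζ) (tangent X 0 ζ) * secondForm G X 1 1 ζ
    - 2 * dot (G (X ζ)) (tangent X 0 ζ) (tangent X 1 ζ) * secondForm G X 0 1 ζ) ξ (1, 0) = 0 := by
    have : (fun ζ => dot (G (X ζ)) (tangent X 1 ζ) (tangent X 1 ζ) * secondForm G X 0 0 ζ
      + dot (G (X ζ)) (tangent X 0 ζ) (tangent X 0 ζ) * secondForm G X 1 1 ζ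
      - 2 * dot (G (X ζ)) (tangent X 0 ζ) (tangent X 1 ζ) * secondForm G X 0 1 ζ)
        =ᶠ[nhds ξ] fun _ => 0 := h.eventually_nhds.mono fun ζ hζ => expansion_eq_zero hζ
    rw [this.fderiv_eq]; simp
  rw [fderiv_fun_sub (((hd (hq 1 1)).fun_mul (hd (hΘ 0 0))).fun_add
      ((hd (hq 0 0)).fun_mul (hd (hΘ 1 1)))) (((hd (hq 0 1)).const_mul 2).fun_mul (hd (hΘ 0 1))),
    fderiv_fun_add ((hd (hq 1 1)).fun_mul (hd (hΘ 0 0))) ((hd (hq 0 0)).fun_mul (hd (hΘ 1 1))),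
    fderiv_fun_mul (hd (hq 1 1)) (hd (hΘ 0 0)), fderiv_fun_mul (hd (hq 0 0)) (hd (hΘ 1 1)),
    fderiv_fun_mul ((hd (hq 0 1)).const_mul 2) (hd (hΘ 0 1)), fderiv_const_mul (hd (hq 0 1))] at hF
  simp only [sub_apply, add_apply, smul_apply, smul_eq_mul, dq] at hF
  have hR := h0.ricci (tangentOne X ξ) (tangentOne X ξ)
  rw [h0.frame.ricciContract_eq,
    riemannContract_self_left hr.symm hr.smooth_metric hr.det_ne_zero,
    riemannContract_self_right] at hR
  simp only [riemannContract_tangent_one h] at hR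
  have hdot (A B : Fin 2) := h0.frame.dot_eq (nablaAlong G X (dir A) (tangentOne X) ξ)
    (nablaAlong G X (dir B) (tangentOne X) ξ)
  simp only [dot_nabla_one_one h] at hdot
  have hdp := h0.frame.det_pos
  have hp := h0.frame.pos
  have hexp := expansion_eq_zero h
  have hs : secondForm G X 1 0 ξ = secondForm G X 0 1 ξ := secondForm_symm h 1 0
  have hs' : fderiv ℝ (secondForm G X 1 0) ξ = fderiv ℝ (secondForm G X 0 1) ξ :=
    Filter.EventuallyEq.fderiv_eq (h.eventually_nhds.mono fun ζ hζ => secondForm_symm hζ 1 0)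
  rw [hdot 0 0, hdot 0 1, hdot 1 0, hdot 1 1] at hR
  simp only [← secondForm.eq_def] at hR
  rw [hs, hs'] at hR
  rw [zero_add, zero_add] at hR
  have hnum := (div_eq_zero_iff.mp hR).resolve_right hdp.ne'
  simp only [div_eq_mul_inv] at hnum
  have hi := mul_inv_cancel₀ hdp.ne'
  -- All traces are with the adjugate of q, and Θ is trace-free. By `hF` and ∂₁q = 2Θ, the trace of
  -- ∂₁Θ is -4 det Θ; by Cayley-Hamilton the trace of Θ q⁻¹ Θ is -2 det Θ. Hence Ric(n,n) = 0
  -- reduces to 2 det Θ = 0.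
  have hdet : secondForm G X 0 0 ξ * secondForm G X 1 1 ξ - secondForm G X 0 1 ξ ^ 2 = 0 := by
    linear_combination (1 / 2) * hnum + (1 / 2) * hF
      - (dot (G (X ξ)) (nablaAlong G X (1, 0) (tangentOne X) ξ) (L ξ) / 2
        + (dot (G (X ξ)) (tangent X 1 ξ) (tangent X 1 ξ) * secondForm G X 0 0 ξ
          + dot (G (X ξ)) (tangent X 0 ξ) (tangent X 0 ξ) * secondForm G X 1 1 ξ
          - 2 * dot (G (X ξ)) (tangent X 0 ξ) (tangent X 1 ξ) * secondForm G X 0 1 ξ)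
        * (dot (G (X ξ)) (tangent X 0 ξ) (tangent X 0 ξ)
            * dot (G (X ξ)) (tangent X 1 ξ) (tangent X 1 ξ)
          - dot (G (X ξ)) (tangent X 0 ξ) (tangent X 1 ξ) ^ 2)⁻¹ / 2) * hexp
      + (secondForm G X 0 0 ξ * secondForm G X 1 1 ξ - secondForm G X 0 1 ξ ^ 2) * hi
  obtain ⟨h00, h01, h11⟩ := eq_zero_of_trace_det hp hdp hexp hdet
  fin_cases A <;> fin_cases B
  · exact h00
  · exact h01
  · exact hs.trans h01
  · exact h11

end Horizon

end CoordGeom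

/-! ### Geometry of the sections: Gauss and Codazzi equations on a totally geodesic horizon. -/

namespace CoordGeom

section Curvature

variable {G : EuclideanSpace ℝ (Fin 4) → Matrix (Fin 4) (Fin 4) ℝ}
  {X L : ℝ × EuclideanSpace ℝ (Fin 2) → EuclideanSpace ℝ (Fin 4)}
  {ξ : ℝ × EuclideanSpace ℝ (Fin 2)}

/-- The metric induced on the section of constant `ξ¹ = s`. -/
noncomputable def inducedMetric (G : EuclideanSpace ℝ (Fin 4) → Matrix (Fin 4) (Fin 4) ℝ)
    (X : ℝ × EuclideanSpace ℝ (Fin 2) → EuclideanSpace ℝ (Fin 4)) (s : ℝ)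
    (y : EuclideanSpace ℝ (Fin 2)) : Matrix (Fin 2) (Fin 2) ℝ :=
  Matrix.of fun A B => dot (G (X (s, y))) (tangent X A (s, y)) (tangent X B (s, y))

/-- The Hajicek one-form `g(∇_A n, ℓ)`. -/
noncomputable def hajicekForm (G : EuclideanSpace ℝ (Fin 4) → Matrix (Fin 4) (Fin 4) ℝ)
    (X L : ℝ × EuclideanSpace ℝ (Fin 2) → EuclideanSpace ℝ (Fin 4))
    (ζ : ℝ × EuclideanSpace ℝ (Fin 2)) (A : Fin 2) : ℝ :=
  dot (G (X ζ)) (nablaAlong G X (dir A) (tangentOne X) ζ) (L ζ)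

/-- The transverse connection `½ (g(∇_A ℓ, e_B) + g(∇_B ℓ, e_A))`. -/
noncomputable def transverseForm (G : EuclideanSpace ℝ (Fin 4) → Matrix (Fin 4) (Fin 4) ℝ)
    (X L : ℝ × EuclideanSpace ℝ (Fin 2) → EuclideanSpace ℝ (Fin 4))
    (ζ : ℝ × EuclideanSpace ℝ (Fin 2)) (A B : Fin 2) : ℝ :=
  (1 / 2) * (dot (G (X ζ)) (nablaAlong G X (dir A) L ζ) (tangent X B ζ)
    + dot (G (X ζ)) (nablaAlong G X (dir B) L ζ) (tangent X A ζ))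

lemma pderiv_section {f : ℝ × EuclideanSpace ℝ (Fin 2) → ℝ} (hf : DifferentiableAt ℝ f ξ)
    (A : Fin 2) : pderiv A (fun y => f (ξ.1, y)) ξ.2 = fderiv ℝ f ξ (dir A) := by
  have h1 : HasFDerivAt (fun y : EuclideanSpace ℝ (Fin 2) => (ξ.1, y))
      (ContinuousLinearMap.inr ℝ ℝ (EuclideanSpace ℝ (Fin 2))) ξ.2 := hasFDerivAt_prodMk_right _ _
  have h2 : HasFDerivAt f (fderiv ℝ f ξ) (ξ.1, ξ.2) := hf.hasFDerivAt
  exact congrArg (fun T : EuclideanSpace ℝ (Fin 2) →L[ℝ] ℝ => T (EuclideanSpace.single A 1))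
    (h2.comp ξ.2 h1).fderiv

lemma isSymm_inducedMetric (hG : ∀ y, (G y).IsSymm) (s : ℝ) (y : EuclideanSpace ℝ (Fin 2)) :
    (inducedMetric G X s y).IsSymm := by
  ext A B
  exact dot_comm (hG _) _ _

lemma contDiffAt_section {f : ℝ × EuclideanSpace ℝ (Fin 2) → ℝ} (hf : ContDiffAt ℝ ∞ f ξ) :
    ContDiffAt ℝ ∞ (fun y => f (ξ.1, y)) ξ.2 :=
  ContDiffAt.comp ξ.2 (g := f) hf (contDiffAt_const.prodMk contDiffAt_id)

lemma RegularAt.contDiffAt_inducedMetric (h : RegularAt G X ξ) (A B : Fin 2) :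
    ContDiffAt ℝ ∞ (fun y => inducedMetric G X ξ.1 y A B) ξ.2 :=
  contDiffAt_section (f := fun ζ => dot (G (X ζ)) (tangent X A ζ) (tangent X B ζ))
    (h.contDiffAt_dot (h.smooth_tangent A) (h.smooth_tangent B))

/-- The tangential part of `∇_A e_B` is given by the Christoffel symbols of the induced metric. -/
lemma RegularAt.christoffelLower_inducedMetric (h : RegularAt G X ξ) (C A B : Fin 2) :
    christoffelLower (inducedMetric G X ξ.1) ξ.2 C A B
      = dot (G (X ξ)) (nablaAlong G X (dir A) (tangent X B) ξ) (tangent X C ξ) := by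
  have hd (A B C : Fin 2) : pderiv A (fun y => inducedMetric G X ξ.1 y B C) ξ.2
      = dot (G (X ξ)) (nablaAlong G X (dir A) (tangent X B) ξ) (tangent X C ξ)
        + dot (G (X ξ)) (nablaAlong G X (dir A) (tangent X C) ξ) (tangent X B ξ) := by
    rw [dot_comm (h.symm _) _ (tangent X B ξ), ← h.fderiv_dot (h.smooth_tangent B)
      (h.smooth_tangent C)]
    exact pderiv_section (f := fun ζ => dot (G (X ζ)) (tangent X B ζ) (tangent X C ζ))
      ((h.contDiffAt_dot (h.smooth_tangent B) (h.smooth_tangent C)).differentiableAt (by simp)) A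
  rw [christoffelLower, hd, hd, hd, h.nabla_tangent_comm C A, h.nabla_tangent_comm C B,
    h.nabla_tangent_comm B A]
  ring

/-- `X` parametrises a vacuum non-expanding horizon near `ξ`, and the metric of the section through
`ξ` is the identity matrix at `ξ`. -/
structure UnitHorizonAt (G : EuclideanSpace ℝ (Fin 4) → Matrix (Fin 4) (Fin 4) ℝ)
    (X L : ℝ × EuclideanSpace ℝ (Fin 2) → EuclideanSpace ℝ (Fin 4))
    (ξ : ℝ × EuclideanSpace ℝ (Fin 2)) : Prop where
  eventually : ∀ᶠ ζ in nhds ξ, HorizonAt G X L ζ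
  unit : inducedMetric G X ξ.1 ξ.2 = 1

namespace UnitHorizonAt

lemma regular (h : UnitHorizonAt G X L ξ) : RegularAt G X ξ := h.eventually.self_of_nhds.regular

lemma dot_tangent (h : UnitHorizonAt G X L ξ) (A B : Fin 2) :
    dot (G (X ξ)) (tangent X A ξ) (tangent X B ξ) = (1 : Matrix (Fin 2) (Fin 2) ℝ) A B :=
  congrFun (congrFun h.unit A) B

lemma dot_eq (h : UnitHorizonAt G X L ξ) (u v : EuclideanSpace ℝ (Fin 4)) :
    dot (G (X ξ)) u v = dot (G (X ξ)) u (tangentOne X ξ) * dot (G (X ξ)) v (L ξ)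
      + dot (G (X ξ)) u (L ξ) * dot (G (X ξ)) v (tangentOne X ξ)
      + dot (G (X ξ)) u (tangent X 0 ξ) * dot (G (X ξ)) v (tangent X 0 ξ)
      + dot (G (X ξ)) u (tangent X 1 ξ) * dot (G (X ξ)) v (tangent X 1 ξ) := by
  rw [h.eventually.self_of_nhds.frame.dot_eq u v]
  simp only [h.dot_tangent]
  simp
  ring

lemma ricci_eq (h : UnitHorizonAt G X L ξ) (Y Z : EuclideanSpace ℝ (Fin 4)) :
    riemannContract G (X ξ) (tangentOne X ξ) Y (L ξ) Z
      + riemannContract G (X ξ) (L ξ) Y (tangentOne X ξ) Z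
      + riemannContract G (X ξ) (tangent X 0 ξ) Y (tangent X 0 ξ) Z
      + riemannContract G (X ξ) (tangent X 1 ξ) Y (tangent X 1 ξ) Z = 0 := by
  have h0 := h.eventually.self_of_nhds
  rw [← h0.ricci Y Z, h0.frame.ricciContract_eq]
  simp only [h.dot_tangent]
  simp
  ring

lemma dot_nabla_tangent_one (h : UnitHorizonAt G X L ξ) (A B : Fin 2) :
    dot (G (X ξ)) (nablaAlong G X (dir A) (tangent X B) ξ) (tangentOne X ξ) = 0 := by
  have := CoordGeom.dot_nabla_tangent_one h.eventually (dir A) B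
  rw [this, neg_eq_zero]
  exact secondForm_eq_zero h.eventually A B

lemma dot_nabla_one_tangent (h : UnitHorizonAt G X L ξ) (A B : Fin 2) :
    dot (G (X ξ)) (nablaAlong G X (dir A) (tangentOne X) ξ) (tangent X B ξ) = 0 :=
  secondForm_eq_zero h.eventually A B

/-- The derivatives of the normal are proportional to the normal. -/
lemma dot_nabla_one (h : UnitHorizonAt G X L ξ) (A : Fin 2) (u : EuclideanSpace ℝ (Fin 4)) :
    dot (G (X ξ)) u (nablaAlong G X (dir A) (tangentOne X) ξ)
      = dot (G (X ξ)) u (tangentOne X ξ) * hajicekForm G X L ξ A := by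
  rw [h.dot_eq, dot_nabla_one_one h.eventually, h.dot_nabla_one_tangent, h.dot_nabla_one_tangent,
    hajicekForm]
  ring

lemma secondForm_eventuallyEq (h : UnitHorizonAt G X L ξ) (A B : Fin 2) :
    secondForm G X A B =ᶠ[nhds ξ] fun _ => 0 :=
  h.eventually.eventually_nhds.mono fun _ hζ => secondForm_eq_zero hζ A B

/-- Gives Ψ₀ = 0. Θ vanishes near the point, hence so does its derivative, and ∇_A n, ∇_B n are
multiples of the null vector n. -/
lemma riemann_tangent_one_tangent_one (h : UnitHorizonAt G X L ξ) (A B : Fin 2) :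
    riemannContract G (X ξ) (tangent X B ξ) (tangentOne X ξ) (tangent X A ξ) (tangentOne X ξ)
      = 0 := by
  rw [riemannContract_tangent_one h.eventually, (h.secondForm_eventuallyEq A B).fderiv_eq,
    secondForm_eq_zero h.eventually, h.dot_nabla_one, dot_nabla_one_one h.eventually]
  simp

/-- The Codazzi equation for n: the derivatives of Θ vanish, and g(∇_A e_B, ∇_C n) = Ω_C g(∇_A e_B,
n) = 0. -/
lemma riemann_tangent_one_tangent_tangent (h : UnitHorizonAt G X L ξ) (A B C : Fin 2) :
    riemannContract G (X ξ) (tangent X B ξ) (tangentOne X ξ) (tangent X A ξ) (tangent X C ξ)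
      = 0 := by
  have h0 := h.regular
  have e := h0.riemannContract_eq h0.smooth_tangentOne (h0.smooth_tangent B) (dir A) (dir C)
  have e2 (A : Fin 2) :
      (fun ζ => dot (G (X ζ)) (tangent X B ζ) (nablaAlong G X (dir A) (tangentOne X) ζ))
      = secondForm G X A B := funext fun ζ => dot_comm (h0.symm _) _ _
  rw [e2, e2, (h.secondForm_eventuallyEq _ _).fderiv_eq, (h.secondForm_eventuallyEq _ _).fderiv_eq,
    h.dot_nabla_one, h.dot_nabla_one, h.dot_nabla_tangent_one, h.dot_nabla_tangent_one] at e
  refine e.trans ?_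
  simp

/-- The only surviving term of Ric(n, e_A) = 0; it gives Ψ₁ = 0. -/
lemma riemann_rigging_one_one_tangent (h : UnitHorizonAt G X L ξ) (A : Fin 2) :
    riemannContract G (X ξ) (L ξ) (tangentOne X ξ) (tangentOne X ξ) (tangent X A ξ) = 0 := by
  have h0 := h.regular
  have := h.ricci_eq (tangentOne X ξ) (tangent X A ξ)
  rw [h.riemann_tangent_one_tangent_tangent, h.riemann_tangent_one_tangent_tangent,
    riemannContract_self_left h0.symm h0.smooth_metric h0.det_ne_zero] at this
  linarith

lemma smooth_hajicekForm (h : UnitHorizonAt G X L ξ) (A : Fin 2) :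
    ContDiffAt ℝ ∞ (fun ζ => hajicekForm G X L ζ A) ξ :=
  h.regular.contDiffAt_dot (h.regular.contDiffAt_nablaAlong h.regular.smooth_tangentOne _)
    h.eventually.self_of_nhds.smooth_rigging

/-- The quadratic terms g(∇_A ℓ, ∇_B n) = -Ω_A Ω_B are symmetric and cancel, so only the curl of Ω
remains. -/
lemma riemann_rigging_one_tangent_tangent (h : UnitHorizonAt G X L ξ) (A B : Fin 2) :
    riemannContract G (X ξ) (L ξ) (tangentOne X ξ) (tangent X A ξ) (tangent X B ξ)
      = pderiv A (fun y => hajicekForm G X L (ξ.1, y) B) ξ.2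
        - pderiv B (fun y => hajicekForm G X L (ξ.1, y) A) ξ.2 := by
  have h0 := h.regular
  have e := h0.riemannContract_eq h0.smooth_tangentOne h.eventually.self_of_nhds.smooth_rigging
    (dir A) (dir B)
  have e2 (A : Fin 2) : (fun ζ => dot (G (X ζ)) (L ζ) (nablaAlong G X (dir A) (tangentOne X) ζ))
      = fun ζ => hajicekForm G X L ζ A := funext fun ζ => dot_comm (h0.symm _) _ _
  rw [e2, e2, h.dot_nabla_one, h.dot_nabla_one, dot_nabla_rigging_one h.eventually,
    dot_nabla_rigging_one h.eventually,
    ← pderiv_section ((h.smooth_hajicekForm B).differentiableAt (by simp)),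
    ← pderiv_section ((h.smooth_hajicekForm A).differentiableAt (by simp))] at e
  refine e.trans ?_
  simp only [hajicekForm]
  ring

lemma curl_hajicekForm (h : UnitHorizonAt G X L ξ) (A B : Fin 2) :
    covDerivOneForm (inducedMetric G X ξ.1) (fun y => hajicekForm G X L (ξ.1, y)) ξ.2 A B
      - covDerivOneForm (inducedMetric G X ξ.1) (fun y => hajicekForm G X L (ξ.1, y)) ξ.2 B A
      = riemannContract G (X ξ) (L ξ) (tangentOne X ξ) (tangent X A ξ) (tangent X B ξ) := by
  rw [h.riemann_rigging_one_tangent_tangent]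
  simp only [covDerivOneForm, christoffel_symm (isSymm_inducedMetric h.regular.symm ξ.1) _ A B]
  ring

lemma det_inducedMetric (h : UnitHorizonAt G X L ξ) : (inducedMetric G X ξ.1 ξ.2).det ≠ 0 := by
  rw [h.unit]; simp

lemma christoffel_inducedMetric (h : UnitHorizonAt G X L ξ) (C A B : Fin 2) :
    christoffel (inducedMetric G X ξ.1) ξ.2 C A B
      = dot (G (X ξ)) (nablaAlong G X (dir A) (tangent X B) ξ) (tangent X C ξ) := by
  rw [← h.regular.christoffelLower_inducedMetric, ← sum_mul_christoffel h.det_inducedMetric, h.unit]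
  simp [Matrix.one_apply]

/-- Differentiation needs the formula at nearby points, where q need not be δ; hence the lowered
symbols, for which it holds without normalising q. -/
lemma pderiv_christoffelLower_inducedMetric (h : UnitHorizonAt G X L ξ) (D C A B : Fin 2) :
    pderiv D (fun y => christoffelLower (inducedMetric G X ξ.1) y C A B) ξ.2
      = fderiv ℝ (fun ζ => dot (G (X ζ)) (tangent X C ζ) (nablaAlong G X (dir A) (tangent X B) ζ)) ξ
        (dir D) := by
  have h0 := h.regular
  have hc : ContinuousAt (fun y : EuclideanSpace ℝ (Fin 2) => (ξ.1, y)) ξ.2 := by fun_prop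
  have e : (fun y => christoffelLower (inducedMetric G X ξ.1) y C A B) =ᶠ[nhds ξ.2] fun y =>
      (fun ζ => dot (G (X ζ)) (tangent X C ζ) (nablaAlong G X (dir A) (tangent X B) ζ)) (ξ.1, y) :=
    (hc.eventually (p := fun ζ => HorizonAt G X L ζ) h.eventually).mono fun y hy =>
      (hy.regular.christoffelLower_inducedMetric C A B).trans (dot_comm (hy.regular.symm _) _ _)
  rw [← pderiv_section ((h0.contDiffAt_dot (h0.smooth_tangent C)
    (h0.contDiffAt_nablaAlong (h0.smooth_tangent B) _)).differentiableAt (by simp)), pderiv,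
    e.fderiv_eq, pderiv]

/-- Gauss' equation. -/
lemma riemann_inducedMetric (h : UnitHorizonAt G X L ξ) (A B C D : Fin 2) :
    riemann (inducedMetric G X ξ.1) ξ.2 A B C D
      = riemannContract G (X ξ) (tangent X A ξ) (tangent X B ξ) (tangent X C ξ) (tangent X D ξ) := by
  have h0 := h.regular
  have e := h0.riemannContract_eq (h0.smooth_tangent B) (h0.smooth_tangent A) (dir C) (dir D)
  rw [riemann_eq (isSymm_inducedMetric h0.symm ξ.1) h0.contDiffAt_inducedMetric h.det_inducedMetric,
    h.pderiv_christoffelLower_inducedMetric, h.pderiv_christoffelLower_inducedMetric]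
  refine Eq.trans ?_ e.symm
  -- In the frame expansion of g(∇_C e_A, ∇_D e_B) every n-ℓ cross term has a factor g(∇e, n) = 0;
  -- the tangential terms are the ΓΓ terms of the intrinsic curvature.
  rw [h.dot_eq (nablaAlong G X (dir C) (tangent X A) ξ),
    h.dot_eq (nablaAlong G X (dir D) (tangent X A) ξ)]
  simp only [h.dot_nabla_tangent_one, h0.christoffelLower_inducedMetric,
    h.christoffel_inducedMetric, Fin.sum_univ_two]
  ring

lemma scalarCurvature_inducedMetric (h : UnitHorizonAt G X L ξ) :
    scalarCurvature (inducedMetric G X ξ.1) ξ.2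
      = 2 * riemannContract G (X ξ) (tangent X 0 ξ) (tangent X 1 ξ) (tangent X 0 ξ)
        (tangent X 1 ξ) := by
  have h0 := h.regular
  have e (s r m n : Fin 2) : riemannUp (inducedMetric G X ξ.1) ξ.2 s r m n
      = riemannContract G (X ξ) (tangent X s ξ) (tangent X r ξ) (tangent X m ξ)
        (tangent X n ξ) := by
    rw [← h.riemann_inducedMetric, riemann, h.unit]
    simp [Matrix.one_apply]
  simp only [scalarCurvature, ricci, Fin.sum_univ_two, e, h.unit, inv_one, Matrix.one_apply,
    riemannContract_self_right]
  rw [riemannContract_antisymm_left h0.symm h0.smooth_metric h0.det_ne_zero (tangent X 1 ξ),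
    riemannContract_antisymm_right (tangent X 0 ξ) (tangent X 1 ξ) (tangent X 1 ξ)]
  simp
  ring

/-- The symmetrisation in Ξ is vacuous: g(∇_A ℓ, e_B) = -g(ℓ, ∇_A e_B) is already symmetric, as ℓ is
orthogonal to the sections. -/
lemma transverseForm_eventuallyEq (h : UnitHorizonAt G X L ξ) (A B : Fin 2) :
    (fun ζ => transverseForm G X L ζ A B) =ᶠ[nhds ξ]
      fun ζ => dot (G (X ζ)) (tangent X B ζ) (nablaAlong G X (dir A) L ζ) :=
  h.eventually.eventually_nhds.mono fun ζ hζ => by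
    have hr := hζ.self_of_nhds.regular
    have h1 := dot_nabla_tangent_rigging hζ (dir A) B
    have h2 := dot_nabla_tangent_rigging hζ (dir B) A
    rw [hr.nabla_tangent_comm] at h1
    simp only [transverseForm]
    rw [dot_comm (hr.symm _) (tangent X B ζ)]
    linarith

/-- The Codazzi equation for the rigging. -/
lemma riemann_tangent_rigging_tangent_tangent (h : UnitHorizonAt G X L ξ) (A B C : Fin 2) :
    riemannContract G (X ξ) (tangent X C ξ) (L ξ) (tangent X A ξ) (tangent X B ξ)
      = covDerivTwoTensor (inducedMetric G X ξ.1) (fun y => transverseForm G X L (ξ.1, y)) ξ.2 A B C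
        - covDerivTwoTensor (inducedMetric G X ξ.1) (fun y => transverseForm G X L (ξ.1, y)) ξ.2 B A C
        + (hajicekForm G X L ξ A * transverseForm G X L ξ B C
          - hajicekForm G X L ξ B * transverseForm G X L ξ A C) := by
  have h0 := h.regular
  have hL := h.eventually.self_of_nhds.smooth_rigging
  have e := h0.riemannContract_eq hL (h0.smooth_tangent C) (dir A) (dir B)
  have hs (A B : Fin 2) : DifferentiableAt ℝ (fun ζ => transverseForm G X L ζ A B) ξ :=
    ((h0.contDiffAt_dot (h0.smooth_tangent B) (h0.contDiffAt_nablaAlong hL _)).congr_of_eventuallyEq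
      (h.transverseForm_eventuallyEq A B)).differentiableAt (by simp)
  have hT (A B : Fin 2) : dot (G (X ξ)) (nablaAlong G X (dir A) L ξ) (tangent X B ξ)
      = transverseForm G X L ξ A B :=
    (dot_comm (h0.symm _) _ _).trans (h.transverseForm_eventuallyEq A B).self_of_nhds.symm
  rw [← (h.transverseForm_eventuallyEq B C).fderiv_eq, ← (h.transverseForm_eventuallyEq A C).fderiv_eq,
    ← pderiv_section (hs B C), ← pderiv_section (hs A C),
    h.dot_eq (nablaAlong G X (dir A) (tangent X C) ξ),
    h.dot_eq (nablaAlong G X (dir B) (tangent X C) ξ)] at e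
  refine e.trans ?_
  -- In g(∇_A e_C, ∇_B ℓ) the cross term g(∇_A e_C, ℓ) g(∇_B ℓ, n) = Ξ_AC Ω_B gives the ΩΞ part, and
  -- the tangential terms give the Christoffel symbols of D acting on the last index; those acting
  -- on the first index cancel by symmetry.
  simp only [h.dot_nabla_tangent_one, dot_nabla_tangent_rigging h.eventually,
    dot_nabla_rigging_one h.eventually, hT, ← hajicekForm.eq_def, covDerivTwoTensor,
    h.christoffel_inducedMetric, Fin.sum_univ_two, h0.nabla_tangent_comm B A]
  ring

end UnitHorizonAt

end Curvature

end CoordGeom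

/-! ### The Weyl tensor in vacuum and its complex contractions. -/

namespace CoordGeom

section Weyl

variable {G : EuclideanSpace ℝ (Fin 4) → Matrix (Fin 4) (Fin 4) ℝ} {x : EuclideanSpace ℝ (Fin 4)}

lemma weyl_eq_riemann (h : ∀ μ ν, ricci G x μ ν = 0) (s r m n : Fin 4) :
    weyl G x s r m n = riemann G x s r m n := by
  simp [weyl, schouten, scalarCurvature, h]

lemma weylContract_ofReal (h : ∀ μ ν, ricci G x μ ν = 0) (A B C D : EuclideanSpace ℝ (Fin 4)) :
    weylContract G x (fun μ => (A μ : ℂ)) (fun μ => (B μ : ℂ)) (fun μ => (C μ : ℂ))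
      (fun μ => (D μ : ℂ)) = (riemannContract G x A B C D : ℂ) := by
  simp only [weylContract, riemannContract, weyl_eq_riemann h]
  push_cast
  rfl

/-- Linearity is needed only in slots two to four, since `m` and `m̄` never occupy the first slot of
a Weyl scalar; `c` is ± i and `d` is √2. -/
lemma weylContract_lin_two (A B B' C D : Fin 4 → ℂ) (c d : ℂ) :
    weylContract G x A (fun μ => (B μ + c * B' μ) / d) C D
      = (weylContract G x A B C D + c * weylContract G x A B' C D) / d := by
  simp only [weylContract, Finset.mul_sum, ← Finset.sum_add_distrib, Finset.sum_div]
  exact Finset.sum_congr rfl fun _ _ => Finset.sum_congr rfl fun _ _ => Finset.sum_congr rfl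
    fun _ _ => Finset.sum_congr rfl fun _ _ => by ring

lemma weylContract_lin_three (A B C C' D : Fin 4 → ℂ) (c d : ℂ) :
    weylContract G x A B (fun μ => (C μ + c * C' μ) / d) D
      = (weylContract G x A B C D + c * weylContract G x A B C' D) / d := by
  simp only [weylContract, Finset.mul_sum, ← Finset.sum_add_distrib, Finset.sum_div]
  exact Finset.sum_congr rfl fun _ _ => Finset.sum_congr rfl fun _ _ => Finset.sum_congr rfl
    fun _ _ => Finset.sum_congr rfl fun _ _ => by ring

lemma weylContract_lin_four (A B C D D' : Fin 4 → ℂ) (c d : ℂ) :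
    weylContract G x A B C (fun μ => (D μ + c * D' μ) / d)
      = (weylContract G x A B C D + c * weylContract G x A B C D') / d := by
  simp only [weylContract, Finset.mul_sum, ← Finset.sum_add_distrib, Finset.sum_div]
  exact Finset.sum_congr rfl fun _ _ => Finset.sum_congr rfl fun _ _ => Finset.sum_congr rfl
    fun _ _ => Finset.sum_congr rfl fun _ _ => by ring

end Weyl

end CoordGeom

/-! ### The coordinate form of the hypersurface satisfies the horizon hypotheses near the point. -/

namespace NullHypersurface

open CoordGeom

variable {M : Type*} [TopologicalSpace M] [ChartedSpace (EuclideanSpace ℝ (Fin 4)) M]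
  [IsManifold (𝓡 4) ∞ M] {g : LorentzMetric M} (H : NullHypersurface g)
  {φ : OpenPartialHomeomorph M (EuclideanSpace ℝ (Fin 4))}
  {ψ : OpenPartialHomeomorph TwoSphere (EuclideanSpace ℝ (Fin 2))}
  {ξ : ℝ × EuclideanSpace ℝ (Fin 2)}

lemma ricci_embed (hvac : g.IsVacuumOn (Set.range H.Φ))
    (hφ : φ ∈ IsManifold.maximalAtlas (𝓡 4) ∞ M) (hξφ : H.point ψ ξ ∈ φ.source) (μ ν : Fin 4) :
    ricci (g.coord φ) (H.embed φ ψ ξ) μ ν = 0 :=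
  hvac φ hφ _ hξφ ⟨_, rfl⟩ μ ν

lemma isNullFrame (hφ : φ ∈ IsManifold.maximalAtlas (𝓡 4) ∞ M)
    (hψ : ψ ∈ IsManifold.maximalAtlas (𝓡 2) ∞ TwoSphere)
    (hξ : ξ.2 ∈ ψ.target) (hξφ : H.point ψ ξ ∈ φ.source)
    (hpos : 0 < H.q φ ψ ξ 0 0) (hdet : 0 < H.q φ ψ ξ 0 0 * H.q φ ψ ξ 1 1 - H.q φ ψ ξ 0 1 ^ 2) :
    IsNullFrame (g.coord φ (H.embed φ ψ ξ)) (tangentOne (H.embed φ ψ) ξ) (H.rigging φ ψ ξ)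
      fun A => tangent (H.embed φ ψ) A ξ where
  symm := g.isSymm_coord _ _
  nn := H.dot_normal_tangent hφ hψ hξ hξφ 1 0
  ne _ := H.dot_normal_tangent hφ hψ hξ hξφ 0 _
  ln := H.dot_rigging_tangent hφ hψ hξ hξφ 1 0
  ll := H.dot_rigging_rigging hφ hξφ
  le _ := H.dot_rigging_tangent hφ hψ hξ hξφ 0 _
  pos := hpos
  det_pos := hdet

lemma horizonAt (hNEH : H.IsNonExpanding) (hvac : g.IsVacuumOn (Set.range H.Φ))
    (hφ : φ ∈ IsManifold.maximalAtlas (𝓡 4) ∞ M)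
    (hψ : ψ ∈ IsManifold.maximalAtlas (𝓡 2) ∞ TwoSphere)
    (hξ : ξ.2 ∈ ψ.target) (hξφ : H.point ψ ξ ∈ φ.source)
    (hpos : 0 < H.q φ ψ ξ 0 0) (hdet : 0 < H.q φ ψ ξ 0 0 * H.q φ ψ ξ 1 1 - H.q φ ψ ξ 0 1 ^ 2) :
    HorizonAt (g.coord φ) (H.embed φ ψ) (H.rigging φ ψ) ξ := by
  have hframe := H.isNullFrame hφ hψ hξ hξφ hpos hdet
  refine ⟨⟨g.isSymm_coord φ, fun i j => g.contDiffAt_coord hφ (φ.map_source hξφ) i j,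
    hframe.det_ne_zero, H.contDiffAt_embed hφ hψ hξ hξφ⟩, H.contDiffAt_rigging hφ hψ hξ hξφ, hframe,
    fun Y Z => ?_, ?_⟩
  · simp [ricciContract, H.ricci_embed hvac hφ hξφ]
  · have h := hNEH φ hφ ψ hψ ξ hξ hξφ
    have hsymm : H.q φ ψ ξ 1 0 = H.q φ ψ ξ 0 1 := dot_comm (g.isSymm_coord φ _) _ _
    have hd : (H.q φ ψ ξ).det = H.q φ ψ ξ 0 0 * H.q φ ψ ξ 1 1 - H.q φ ψ ξ 0 1 ^ 2 := by
      rw [Matrix.det_fin_two, hsymm]; ring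
    simp only [expansion, Fin.sum_univ_two, Matrix.inv_def, Matrix.adjugate_fin_two, hd,
      Ring.inverse_eq_inv', hsymm] at h
    simp at h
    change H.q φ ψ ξ 1 1 * H.secondFundamentalForm φ ψ ξ 0 0
      + H.q φ ψ ξ 0 0 * H.secondFundamentalForm φ ψ ξ 1 1
      - H.q φ ψ ξ 0 1
        * (H.secondFundamentalForm φ ψ ξ 0 1 + H.secondFundamentalForm φ ψ ξ 1 0) = 0
    have hi := mul_inv_cancel₀ hdet.ne'
    -- The expansion is the adjugate trace of Θ divided by det q; multiplying by det q clears the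
    -- denominator.
    linear_combination (H.q φ ψ ξ 0 0 * H.q φ ψ ξ 1 1 - H.q φ ψ ξ 0 1 ^ 2) * h
      - (H.q φ ψ ξ 1 1 * H.secondFundamentalForm φ ψ ξ 0 0
      + H.q φ ψ ξ 0 0 * H.secondFundamentalForm φ ψ ξ 1 1
      - H.q φ ψ ξ 0 1
        * (H.secondFundamentalForm φ ψ ξ 0 1 + H.secondFundamentalForm φ ψ ξ 1 0)) * hi

lemma contDiffAt_q (hφ : φ ∈ IsManifold.maximalAtlas (𝓡 4) ∞ M)
    (hψ : ψ ∈ IsManifold.maximalAtlas (𝓡 2) ∞ TwoSphere)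
    (hξ : ξ.2 ∈ ψ.target) (hξφ : H.point ψ ξ ∈ φ.source) (A B : Fin 2) :
    ContDiffAt ℝ ∞ (fun ζ => H.q φ ψ ζ A B) ξ := by
  have hX := H.contDiffAt_embed hφ hψ hξ hξφ
  exact contDiffAt_dot (A := fun ζ => g.coord φ (H.embed φ ψ ζ))
    (fun i j => ContDiffAt.comp ξ (g := fun y => g.coord φ y i j)
      (g.contDiffAt_coord hφ (φ.map_source hξφ) i j) hX)
    (contDiffAt_fderiv_apply hX _) (contDiffAt_fderiv_apply hX _)

/-- Positivity of the leading minors of q is an open condition, so q = 1 at the point makes q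
positive definite nearby. -/
lemma unitHorizonAt (hNEH : H.IsNonExpanding) (hvac : g.IsVacuumOn (Set.range H.Φ))
    (hφ : φ ∈ IsManifold.maximalAtlas (𝓡 4) ∞ M)
    (hψ : ψ ∈ IsManifold.maximalAtlas (𝓡 2) ∞ TwoSphere)
    (hξ : ξ.2 ∈ ψ.target) (hξφ : H.point ψ ξ ∈ φ.source) (hq : H.q φ ψ ξ = 1) :
    UnitHorizonAt (g.coord φ) (H.embed φ ψ) (H.rigging φ ψ) ξ := by
  refine ⟨?_, hq⟩
  have hc (A B : Fin 2) : ContinuousAt (fun ζ => H.q φ ψ ζ A B) ξ :=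
    (H.contDiffAt_q hφ hψ hξ hξφ A B).continuousAt
  have h1 : ∀ᶠ ζ in nhds ξ, 0 < H.q φ ψ ζ 0 0 :=
    (hc 0 0).eventually (lt_mem_nhds (by simp [hq]))
  have h2 : ∀ᶠ ζ in nhds ξ, 0 < H.q φ ψ ζ 0 0 * H.q φ ψ ζ 1 1 - H.q φ ψ ζ 0 1 ^ 2 :=
    (((hc 0 0).mul (hc 1 1)).sub ((hc 0 1).pow 2)).eventually (lt_mem_nhds (by simp [hq]))
  filter_upwards [H.eventually_mem hψ hξ hξφ, h1, h2] with ζ hζ hpos hdet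
  exact H.horizonAt hNEH hvac hφ hψ hζ.1 hζ.2 hpos hdet

end NullHypersurface

/-! ### Assembly of the Weyl scalars. -/

open CoordGeom in
theorem mainTheorem5 {M : Type*} [TopologicalSpace M]
    [ChartedSpace (EuclideanSpace ℝ (Fin 4)) M] [IsManifold (𝓡 4) ∞ M]
    (g : LorentzMetric M) (H : NullHypersurface g)
    (hNEH : H.IsNonExpanding) (hvac : g.IsVacuumOn (Set.range H.Φ))
    (φ : OpenPartialHomeomorph M (EuclideanSpace ℝ (Fin 4)))
    (hφ : φ ∈ IsManifold.maximalAtlas (𝓡 4) ∞ M)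
    (ψ : OpenPartialHomeomorph TwoSphere (EuclideanSpace ℝ (Fin 2)))
    (hψ : ψ ∈ IsManifold.maximalAtlas (𝓡 2) ∞ TwoSphere)
    (ξ : ℝ × EuclideanSpace ℝ (Fin 2))
    (hξ : ξ.2 ∈ ψ.target) (hξφ : H.point ψ ξ ∈ φ.source)
    (hq : H.q φ ψ ξ = 1) :
    H.Psi0 φ ψ ξ = 0 ∧ H.Psi1 φ ψ ξ = 0 ∧
    (∃ J : ℝ,
      (∀ A B : Fin 2,
        H.dHajicek φ ψ ξ A B - H.dHajicek φ ψ ξ B A = H.volumeForm φ ψ ξ A B * J) ∧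
      H.Psi2 φ ψ ξ =
        -(1 / 4) * (H.sectionCurvature φ ψ ξ : ℂ) + (Complex.I / 2) * (J : ℂ)) ∧
    (H.Psi3 φ ψ ξ).re = (1 / Real.sqrt 2) * H.transverseCurl φ ψ ξ 0 ∧
    (H.Psi3 φ ψ ξ).im = -(1 / Real.sqrt 2) * H.transverseCurl φ ψ ξ 1 := by
  have h := H.unitHorizonAt hNEH hvac hφ hψ hξ hξφ hq
  obtain ⟨hG, hs, hdet, -⟩ := h.regular
  have hric : ∀ μ ν, ricci (g.coord φ) (H.embed φ ψ ξ) μ ν = 0 := H.ricci_embed hvac hφ hξφ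
  set G := g.coord φ
  set X := H.embed φ ψ
  set n := tangentOne X ξ
  set l := H.rigging φ ψ ξ
  set e : Fin 2 → EuclideanSpace ℝ (Fin 4) := fun A => tangent X A ξ
  set R := riemannContract G (X ξ)
  have hRr (A B C D) : R A B C D = -R A B D C := riemannContract_antisymm_right A B C D
  have hRl (A B C D) : R A B C D = -R B A C D := riemannContract_antisymm_left hG hs hdet A B C D
  have hRp (A B C D) : R A B C D = R C D A B := riemannContract_pair_symm hG hs hdet A B C D
  have hRrr (A B C) : R A B C C = 0 := riemannContract_self_right A B C
  have hRll (A B C) : R A A B C = 0 := riemannContract_self_left hG hs hdet A B C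
  have hW (A B C D : EuclideanSpace ℝ (Fin 4)) :
      weylContract G (X ξ) (fun μ => (A μ : ℂ)) (fun μ => (B μ : ℂ)) (fun μ => (C μ : ℂ))
      (fun μ => (D μ : ℂ)) = (R A B C D : ℂ) := weylContract_ofReal hric A B C D
  have hm : H.npM φ ψ ξ = fun μ => ((e 0 μ : ℂ) + Complex.I * (e 1 μ : ℂ)) / (Real.sqrt 2 : ℂ) := rfl
  have hmbar : H.npMbar φ ψ ξ
      = fun μ => ((e 0 μ : ℂ) + -Complex.I * (e 1 μ : ℂ)) / (Real.sqrt 2 : ℂ) := by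
    funext μ
    rw [neg_mul, ← sub_eq_add_neg]; rfl
  have hn : H.npN φ ψ ξ = fun μ => (n μ : ℂ) := rfl
  have hl : H.npL φ ψ ξ = fun μ => (l μ : ℂ) := rfl
  have hsq : (Real.sqrt 2 : ℂ) * (Real.sqrt 2 : ℂ) = 2 := by
    rw [← Complex.ofReal_mul, Real.mul_self_sqrt (by norm_num)]; simp
  have hnn (A B) : R (e A) n (e B) n = 0 := h.riemann_tangent_one_tangent_one B A
  -- The trace of the Codazzi equation for ℓ, converted by Ric(ℓ, e_B) = 0.
  have hcurl (B : Fin 2) : H.transverseCurl φ ψ ξ B = R n l (e B) l := by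
    have hric := h.ricci_eq l (e B)
    have hc (A) : R (e A) l (e A) (e B) = _ := h.riemann_tangent_rigging_tangent_tangent A B A
    have : H.transverseCurl φ ψ ξ B = R (e 0) l (e 0) (e B) + R (e 1) l (e 1) (e B) := by
      rw [hc 0, hc 1]
      simp only [NullHypersurface.transverseCurl, hq, inv_one, Matrix.one_apply, Fin.sum_univ_two]
      simp
      rfl
    rw [this, hRr n l (e B) l]
    have h2 : R l l n (e B) = 0 := hRll _ _ _
    change R n l l (e B) + R l l n (e B) + R (e 0) l (e 0) (e B) + R (e 1) l (e 1) (e B) = 0 at hric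
    linarith
  -- At q = δ the volume form has ε₂₃ = 1, so J is the single independent component of the curl of
  -- Ω.
  refine ⟨?_, ?_, ⟨R l n (e 0) (e 1), fun A B => ?_, ?_⟩, ?_, ?_⟩
  · rw [NullHypersurface.Psi0, hm, hn, weylContract_lin_two, weylContract_lin_four,
      weylContract_lin_four, hW, hW, hW, hW]
    have hz (A B) : R n (e A) n (e B) = 0 := by rw [hRl, hRr, hnn]; simp
    simp [hz]
  · rw [NullHypersurface.Psi1, hm, hn, hl, weylContract_lin_two, hW, hW]
    have hz (A) : R n (e A) l n = 0 := by
      rw [hRp]; exact h.riemann_rigging_one_one_tangent A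
    simp [hz]
  · have hc : H.dHajicek φ ψ ξ A B - H.dHajicek φ ψ ξ B A = R l n (e A) (e B) :=
      h.curl_hajicekForm A B
    rw [hc, NullHypersurface.volumeForm, hq]
    fin_cases A <;> fin_cases B
    · simp [hRrr]
    · simp
    · simp [hRr l n (e 1) (e 0)]
    · simp [hRrr]
  · rw [NullHypersurface.Psi2, hm, hmbar, hn, hl, weylContract_lin_two, weylContract_lin_four,
      weylContract_lin_four, hW, hW, hW, hW]
    have hS : H.sectionCurvature φ ψ ξ = 2 * R (e 0) (e 1) (e 0) (e 1) :=
      h.scalarCurvature_inducedMetric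
    have r0 : R n (e 0) l (e 0) + R l (e 0) n (e 0) + R (e 0) (e 0) (e 0) (e 0)
      + R (e 1) (e 0) (e 1) (e 0) = 0 := h.ricci_eq _ _
    have r1 : R n (e 1) l (e 1) + R l (e 1) n (e 1) + R (e 0) (e 1) (e 0) (e 1)
      + R (e 1) (e 1) (e 1) (e 1) = 0 := h.ricci_eq _ _
    have b : R l n (e 0) (e 1) + R l (e 0) (e 1) n + R l (e 1) n (e 0) = 0 :=
      riemannContract_bianchi hG _ _ _ _
    rw [hRll, hRl (e 1) (e 0), hRr (e 0) (e 1) (e 1) (e 0), hRp l] at r0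
    rw [hRll, hRp l] at r1
    rw [hRr l (e 0), hRp l (e 0), hRp l (e 1)] at b
    -- Twice Ψ₂ has real part R(n,e_2,ℓ,e_2) + R(n,e_3,ℓ,e_3), fixed by the two Ricci equations, and
    -- imaginary part R(n,e_3,ℓ,e_2) - R(n,e_2,ℓ,e_3), fixed by Bianchi.
    have e1 : R n (e 0) l (e 0) + R n (e 1) l (e 1) = -(1 / 2) * H.sectionCurvature φ ψ ξ := by
      rw [hS]; linarith
    have e2 : R n (e 1) l (e 0) - R n (e 0) l (e 1) = R l n (e 0) (e 1) := by linarith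
    have e1' : (R n (e 0) l (e 0) : ℂ) + R n (e 1) l (e 1)
      = -(1 / 2) * (H.sectionCurvature φ ψ ξ : ℂ) := by
      rw [← Complex.ofReal_add, e1]; push_cast; ring
    have e2' : (R n (e 1) l (e 0) : ℂ) - R n (e 0) l (e 1) = R l n (e 0) (e 1) := by
      exact_mod_cast congrArg Complex.ofReal e2
    have hss : (Real.sqrt 2 : ℂ)⁻¹ * (Real.sqrt 2 : ℂ)⁻¹ = 1 / 2 := by
      rw [← mul_inv, hsq, one_div]
    linear_combination ((R n (e 0) l (e 0) : ℂ) - Complex.I * R n (e 0) l (e 1)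
      + Complex.I * R n (e 1) l (e 0) - Complex.I ^ 2 * R n (e 1) l (e 1)) * hss
      + (1 / 2) * e1' + Complex.I / 2 * e2' - (R n (e 1) l (e 1) : ℂ) / 2 * Complex.I_sq
  all_goals
    have h3 : H.Psi3 φ ψ ξ = ((1 / Real.sqrt 2 * R n l (e 0) l : ℝ) : ℂ)
        + ((-(1 / Real.sqrt 2) * R n l (e 1) l : ℝ) : ℂ) * Complex.I := by
      rw [NullHypersurface.Psi3, hmbar, hn, hl, weylContract_lin_three, hW, hW]
      push_cast
      ring
    rw [h3, hcurl]
  · rw [Complex.add_re, Complex.re_ofReal_mul, Complex.I_re, Complex.ofReal_re]; simp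
  · rw [Complex.add_im, Complex.im_ofReal_mul, Complex.I_im, Complex.ofReal_im]; simp
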